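/- For $n\ge 0$ let $S_n$ be the number of score sequences on the complete graph $K_n$, that is, of sequences that list in non-decreasing order the numbers of wins of the vertices in some tournament (orientation of the edges) on $K_n$. For a score sequence $s=(s_1,\dots,s_n)$, the number of irreducible subscores of $s$ is the number of indices $1\le k\le n$ such that $\sum_{i=1}^k s_i=\binom k2$, and $S_{n,m}$ is the number of score sequences on $K_n$ with exactly $m$ irreducible subscores. Let $N_k$ be the number of $k$-element subsets of $\{1,2,\dots,2k-1\}$ whose sum is a multiple of $k$, and put \[ \lambda=\sum_{k=1}^\infty \frac{N_k}{k4^k}, \] a convergent series. Let $\mathcal I_n$ be the number of irreducible subscores of a score sequence chosen uniformly at random among the $S_n$ score sequences on $K_n$. Let $\mathcal N_\lambda$ be a negative binomial (Pascal) random variable with parameters $r=2$ and $p=e^{-\lambda}$, that is, $\mathbf P(\mathcal N_\lambda=k)=(k+1)(1-p)^kp^2$ for $k\ge 0$. Then, as $n\to\infty$, \[ \mathcal I_n \xrightarrow{d} 1+\mathcal N_\lambda . \] That is, for every $m\ge 1$, \[ \mathbf P(\mathcal I_n=m)=\frac{S_{n,m}}{S_n}\to m(1-e^{-\lambda})^{m-1}e^{-2\lambda}=\mathbf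 P(\mathcal N_\lambda=m-1). \] In particular, for every $m\ge 1$, \[ \frac{n^{5/2}S_{n,m}}{4^n}\to \frac{m(1-e^{-\lambda})^{m-1}e^{-\lambda}}{2\sqrt{\pi}} . \] -/

import Mathlib

open MeasureTheory ProbabilityTheory Filter Topology

noncomputable section

namespace ScoreSeq

/-- A tournament on the complete graph `K_n`: every pair of distinct vertices plays one game, which
has exactly one winner. `beats i j` means that `i` wins the game against `j`, i.e. the edge is
directed from `j` to `i`. -/
structure Tournament (n : ℕ) where
  beats : Fin n → Fin n → Prop
  not_beats_self : ∀ i, ¬ beats i i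
  beats_iff : ∀ i j, i ≠ j → (beats i j ↔ ¬ beats j i)

/-- The number of wins (the in-degree) of vertex `i`. -/
def Tournament.score {n : ℕ} (T : Tournament n) (i : Fin n) : ℕ :=
  {j | T.beats i j}.ncard

/-- The score sequence of a tournament: the numbers of wins, in non-decreasing order. -/
def Tournament.scoreSequence {n : ℕ} (T : Tournament n) : Fin n → ℕ :=
  T.score ∘ Tuple.sort T.score

/-- The set of score sequences on `K_n`. -/
def scoreSequences (n : ℕ) : Set (Fin n → ℕ) :=
  Set.range (Tournament.scoreSequence (n := n))

/-- The number of irreducible subscores of `s`: the number of `k ∈ {1, …, n}` such that the sum of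
the first `k` entries of `s` equals `k choose 2`. -/
def numIrreducible {n : ℕ} (s : Fin n → ℕ) : ℕ :=
  {k ∈ Finset.Icc 1 n | ∑ i : Fin n with i.val < k, s i = k.choose 2}.card

/-- `S n` is the number of score sequences on `K_n`. -/
def S (n : ℕ) : ℕ := (scoreSequences n).ncard

/-- `Sirr n m` is the number of score sequences on `K_n` with exactly `m` irreducible subscores. -/
def Sirr (n m : ℕ) : ℕ := {s ∈ scoreSequences n | numIrreducible s = m}.ncard

/-- `N n` is the number of `n`-element subsets of `{1, …, 2n - 1}` whose sum is a multiple
of `n`. -/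
def N (n : ℕ) : ℕ :=
  {A ∈ (Finset.Icc 1 (2 * n - 1)).powersetCard n | n ∣ ∑ a ∈ A, a}.card

/-- The `k`-th term `N_k / (k 4^k)` of the series for `lam`. -/
def lamTerm (k : ℕ) : ℝ := (N k : ℝ) / (k * 4 ^ k)

/-- `λ = ∑_{k ≥ 1} N_k / (k 4^k)`. -/
def lam : ℝ := ∑' k : ℕ, lamTerm (k + 1)

/-- The negative binomial (Pascal) distribution on `{0, 1, 2, …}` with parameters `r` and `p`:
the number of failures before the `r`-th success,
`P(k) = (k + r - 1 choose k) (1 - p)^k p^r`. -/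
def negBinomialMeasure (r : ℕ) (p : ℝ) : Measure ℕ :=
  Measure.sum fun k : ℕ =>
    ENNReal.ofReal (((k + r - 1).choose k : ℝ) * (1 - p) ^ k * p ^ r) • Measure.dirac k

end ScoreSeq

end

/-! By Landau's theorem a score sequence amounts to its excesses `d k = s_1 + ... + s_k - k.choose
2`: nonnegative bridges of length `n` from 0 to 0 with second differences at least -1, whose zeros
in `1, ..., n` are the irreducible subscores. Let `I` be the generating function of irreducible
score sequences. Cutting a bridge at its zeros gives `S = 1 / (1 - I)`, and `I ^ m` for exactly `m`
irreducible subscores.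

The key identity is `N_eq_sum`: the coefficients of `x I'(x) S(x)` are the `N_k`. They count bridges
weighted by the length of the first block. By a cycle-lemma argument this is the number of periodic
bridges without positivity; those correspond to staircases `s (j + n) = s j + n`, and shifting a
staircase so that it crosses zero at the origin encodes it as an `n`-subset of `{1, ..., 2n - 1}`
with sum divisible by `n`. Hence `log S = ∑ N_k x^k / k`, so at `x = 1/4` one has `S = e^λ` and `I =
1 - e^(-λ)`.

A roots-of-unity filter gives `N_n ≈ (2n choose n) / (2n)`, so `N_n / 4^n` is asymptotic to `c
n^(-3/2)` with `c = 1 / (2 √π)`. The recursion `n s_n = ∑ b_k s_(n-k)` transfers this to `S_n / 4^n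
~ c e^λ n^(-5/2)` and, for the inverse series, to `I_n / 4^n ~ c e^(-λ) n^(-5/2)`. In a convolution
of such sequences one factor carries almost all the length, so the coefficients of `I ^ m` behave
like `m (1 - e^(-λ))^(m-1)` times those of `I`. Dividing by `S_n` gives the limit law; the parameter
`r = 2` reflects the blocks before and after the giant one. -/

namespace ScoreSeq

/-! ### Convolutions of sequences with polynomial decay. -/

section Convolution

open Finset

theorem tendsto_rpow_mul_shift {α : ℝ} {v : ℕ → ℝ} {V : ℝ}
    (hv : Tendsto (fun n : ℕ => (n : ℝ) ^ α * v n) atTop (𝓝 V)) (k : ℕ) :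
    Tendsto (fun n : ℕ => (n : ℝ) ^ α * v (n - k)) atTop (𝓝 V) := by
  rw [← tendsto_add_atTop_iff_nat k]
  have h1 : Tendsto (fun n : ℕ => (1 + (k : ℝ) / n) ^ α) atTop (𝓝 1) := by
    have : Tendsto (fun n : ℕ => 1 + (k : ℝ) / n) atTop (𝓝 (1 + 0)) :=
      tendsto_const_nhds.add (tendsto_const_div_atTop_nhds_zero_nat _)
    rw [add_zero] at this
    simpa using this.rpow_const (p := α) (Or.inl one_ne_zero)
  have h2 := h1.mul hv
  rw [one_mul] at h2
  refine h2.congr' ?_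
  filter_upwards [eventually_gt_atTop 0] with n hn
  have hn' : (0 : ℝ) < n := by exact_mod_cast hn
  rw [← mul_assoc, ← Real.mul_rpow (by positivity) hn'.le, Nat.add_sub_cancel]
  congr 2
  push_cast
  field_simp

/-- For `k ≤ n / 2` one has `n ^ α ≤ 2 ^ α (n - k) ^ α`, so dominated convergence applies with a
multiple of `|u k|` as bound. The predicate `q` is left free so that a middle term `2 * k = n` can
be given to exactly one of the two halves. -/
theorem tendsto_half_convolution {α : ℝ} (hα : 0 ≤ α) {u v : ℕ → ℝ} {V : ℝ}
    (q : ℕ → ℕ → Prop) [∀ n k, Decidable (q n k)] (hq : ∀ n k, q n k → 2 * k ≤ n)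
    (hq' : ∀ k, ∀ᶠ n in atTop, q n k) (hu : Summable u)
    (hv : Tendsto (fun n : ℕ => (n : ℝ) ^ α * v n) atTop (𝓝 V)) :
    Tendsto (fun n : ℕ => (n : ℝ) ^ α *
      ∑ p ∈ antidiagonal n, if q n p.1 then u p.1 * v p.2 else 0) atTop (𝓝 (V * ∑' k, u k)) := by
  obtain ⟨M, hM⟩ := (Metric.isBounded_range_of_tendsto _ hv).exists_norm_le
  have hM' : ∀ m : ℕ, (m : ℝ) ^ α * |v m| ≤ M := fun m => by
    have := hM _ ⟨m, rfl⟩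
    rwa [norm_mul, Real.norm_eq_abs, Real.norm_eq_abs,
      abs_of_nonneg (Real.rpow_nonneg (Nat.cast_nonneg m) α)] at this
  rw [← tsum_mul_left]
  have key : Tendsto (fun n : ℕ => ∑' k, if q n k then (n : ℝ) ^ α * (u k * v (n - k)) else 0)
      atTop (𝓝 (∑' k, V * u k)) := by
    refine tendsto_tsum_of_dominated_convergence (bound := fun k => 2 ^ α * M * |u k|)
      (hu.abs.mul_left _) (fun k => ?_) (Eventually.of_forall fun n k => ?_)
    · have := (tendsto_rpow_mul_shift hv k).mul_const (u k)
      refine this.congr' ?_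
      filter_upwards [hq' k] with n hn
      rw [if_pos hn]; ring
    · split_ifs with h
      · have h2 := hq n k h
        have h3 : (n : ℝ) ≤ 2 * ((n - k : ℕ) : ℝ) := by
          have : n ≤ 2 * (n - k) := by omega
          exact_mod_cast this
        have h4 : (n : ℝ) ^ α ≤ 2 ^ α * ((n - k : ℕ) : ℝ) ^ α := by
          rw [← Real.mul_rpow (by norm_num) (Nat.cast_nonneg _)]
          exact Real.rpow_le_rpow (Nat.cast_nonneg _) h3 hα
        rw [norm_mul, norm_mul, Real.norm_eq_abs, Real.norm_eq_abs, Real.norm_eq_abs,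
          abs_of_nonneg (Real.rpow_nonneg (Nat.cast_nonneg n) α)]
        calc (n : ℝ) ^ α * (|u k| * |v (n - k)|)
            ≤ (2 ^ α * ((n - k : ℕ) : ℝ) ^ α) * (|u k| * |v (n - k)|) := by gcongr
          _ = 2 ^ α * (((n - k : ℕ) : ℝ) ^ α * |v (n - k)|) * |u k| := by ring
          _ ≤ 2 ^ α * M * |u k| := by gcongr; exact hM' _
      · have : 0 ≤ M := le_trans (by positivity) (hM' 0)
        simp only [norm_zero]; positivity
  refine key.congr fun n => ?_
  rw [Finset.Nat.sum_antidiagonal_eq_sum_range_succ_mk, Finset.mul_sum,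
    tsum_eq_sum (s := range n.succ)]
  · refine Finset.sum_congr rfl fun k _ => ?_
    split_ifs <;> simp
  · intro k hk
    rw [if_neg]
    intro h
    have := hq n k h
    simp at hk
    omega

/-- If `u n` and `v n` are asymptotically multiples of `n ^ (-α)` and summable, so is their
convolution. -/
theorem tendsto_rpow_mul_convolution {α : ℝ} (hα : 0 ≤ α) {u v : ℕ → ℝ} {U V : ℝ}
    (hus : Summable u) (hvs : Summable v)
    (hu : Tendsto (fun n : ℕ => (n : ℝ) ^ α * u n) atTop (𝓝 U))
    (hv : Tendsto (fun n : ℕ => (n : ℝ) ^ α * v n) atTop (𝓝 V)) :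
    Tendsto (fun n : ℕ => (n : ℝ) ^ α * ∑ p ∈ antidiagonal n, u p.1 * v p.2) atTop
      (𝓝 (V * ∑' k, u k + U * ∑' k, v k)) := by
  have h1 := tendsto_half_convolution hα (fun n k => 2 * k ≤ n) (fun _ _ h => h)
    (fun k => eventually_ge_atTop _) hus hv
  have h2 := tendsto_half_convolution hα (fun n k => 2 * k < n) (fun _ _ h => h.le)
    (fun k => eventually_gt_atTop _) hvs hu
  refine (h1.add h2).congr fun n => ?_
  rw [← mul_add]
  congr 1
  rw [← Finset.Nat.sum_antidiagonal_swap (f := fun p : ℕ × ℕ => if 2 * p.1 < n then _ else _),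
    ← Finset.sum_add_distrib]
  refine Finset.sum_congr rfl fun p hp => ?_
  have := mem_antidiagonal.1 hp
  simp only [Prod.fst_swap, Prod.snd_swap]
  by_cases h : 2 * p.1 ≤ n
  · rw [if_pos h, if_neg (by omega), add_zero]
  · rw [if_neg h, if_pos (by omega), zero_add, mul_comm]

end Convolution

/-! ### The recursion `n s_n = ∑ b_k s_(n-k)`: summability, asymptotics, total sum. -/

section Recursion

open Finset

theorem summable_of_tendsto_rpow_mul {α : ℝ} (hα : 1 < α) {u : ℕ → ℝ} {U : ℝ}
    (hu : Tendsto (fun n : ℕ => (n : ℝ) ^ α * u n) atTop (𝓝 U)) : Summable u := by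
  refine summable_of_isBigO_nat (Real.summable_nat_rpow_inv.2 hα) ?_
  have h3 := hu.isBigO_one ℝ
  have h4 := (Asymptotics.isBigO_refl (fun n : ℕ => ((n : ℝ) ^ α)⁻¹) atTop).mul h3
  refine (h4.congr' ?_ ?_)
  · filter_upwards [eventually_gt_atTop 0] with n hn
    have hn' : (0 : ℝ) < n := by exact_mod_cast hn
    have := (Real.rpow_pos_of_pos hn' α).ne'
    field_simp
  · exact Eventually.of_forall fun n => by simp

theorem tendsto_rpow_mul_zero_of_lt {α β : ℝ} (h : β < α) {u : ℕ → ℝ} {U : ℝ}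
    (hu : Tendsto (fun n : ℕ => (n : ℝ) ^ α * u n) atTop (𝓝 U)) :
    Tendsto (fun n : ℕ => (n : ℝ) ^ β * u n) atTop (𝓝 0) := by
  have h1 : Tendsto (fun n : ℕ => (n : ℝ) ^ (-(α - β))) atTop (𝓝 0) :=
    (tendsto_rpow_neg_atTop (by linarith)).comp tendsto_natCast_atTop_atTop
  have h2 := h1.mul hu
  rw [zero_mul] at h2
  refine h2.congr' ?_
  filter_upwards [eventually_gt_atTop 0] with n hn
  have hn' : (0 : ℝ) < n := by exact_mod_cast hn
  rw [← mul_assoc, ← Real.rpow_add hn']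
  congr 2; ring

variable {s b : ℕ → ℝ}

/-- Once `m ≥ N > 2 B`, the recursion bounds `N |s m|` by the convolution of `|b|` and `|s|`.
Summing, the partial sums of `|s|` reappear on the right with the factor `B < N / 2` and are
absorbed on the left. -/
theorem summable_of_convolution_recursion (hb : Summable b)
    (hs : ∀ n : ℕ, (n : ℝ) * s n = ∑ p ∈ antidiagonal n, b p.1 * s p.2) : Summable s := by
  rw [← summable_abs_iff]
  set B := ∑' k, |b k| with hB
  obtain ⟨N, hN⟩ := exists_nat_gt (2 * B)
  have hB0 : 0 ≤ B := tsum_nonneg fun _ => abs_nonneg _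
  have hN0 : (0 : ℝ) < N := by linarith
  refine summable_of_sum_range_le (c := 2 * ∑ n ∈ range N, |s n|) (fun _ => abs_nonneg _) ?_
  intro n
  have key : (N : ℝ) * ∑ m ∈ range n, |s m| ≤ N * ∑ m ∈ range N, |s m| +
      B * ∑ m ∈ range n, |s m| := by
    have h1 : ∀ m, (N : ℝ) * |s m| ≤ (if m < N then (N : ℝ) * |s m| else 0) +
        ∑ k ∈ range (m + 1), |b k| * |s (m - k)| := by
      intro m
      have h0 : 0 ≤ ∑ k ∈ range (m + 1), |b k| * |s (m - k)| :=
        Finset.sum_nonneg fun _ _ => by positivity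
      split_ifs with h
      · linarith
      · have h2 : (N : ℝ) ≤ m := by exact_mod_cast not_lt.1 h
        have h3 := congrArg abs (hs m)
        rw [abs_mul, Nat.abs_cast, Finset.Nat.sum_antidiagonal_eq_sum_range_succ_mk] at h3
        have h4 := Finset.abs_sum_le_sum_abs (fun k => b k * s (m - k)) (range m.succ)
        simp only [abs_mul] at h4
        have h5 := mul_le_mul_of_nonneg_right h2 (abs_nonneg (s m))
        rw [zero_add]
        exact h5.trans (h3.le.trans h4)
    rw [Finset.mul_sum]
    refine (Finset.sum_le_sum fun m _ => h1 m).trans ?_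
    rw [Finset.sum_add_distrib]
    refine add_le_add ?_ ?_
    · rw [← Finset.sum_filter, ← Finset.mul_sum]
      gcongr
      intro x hx
      simp at hx ⊢
      exact hx.2
    · rw [Finset.sum_range_diag_flip n (fun k m => |b k| * |s m|)]
      calc ∑ m ∈ range n, ∑ k ∈ range (n - m), |b m| * |s k|
          ≤ ∑ m ∈ range n, |b m| * ∑ k ∈ range n, |s k| := by
            refine Finset.sum_le_sum fun m _ => ?_
            rw [Finset.mul_sum]
            refine Finset.sum_le_sum_of_subset_of_nonneg ?_ fun _ _ _ => by positivity
            exact Finset.range_subset_range.2 (Nat.sub_le _ _)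
        _ = (∑ m ∈ range n, |b m|) * ∑ k ∈ range n, |s k| := by rw [Finset.sum_mul]
        _ ≤ B * ∑ k ∈ range n, |s k| := by
            gcongr
            exact hb.abs.sum_le_tsum _ fun _ _ => abs_nonneg _
  have h5 : 0 ≤ ∑ m ∈ range n, |s m| := Finset.sum_nonneg fun _ _ => abs_nonneg _
  have h6 : (N : ℝ) * ∑ m ∈ range n, |s m| ≤ N * (2 * ∑ m ∈ range N, |s m|) := by
    nlinarith
  exact le_of_mul_le_mul_left h6 hN0

/-- Bootstrapping: each use of the recursion gains a factor `n`. From `s n → 0` one gets `n s_n →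
0`, then `n ^ 2 s_n → 0`; now `s` is negligible at the scale `n ^ (3/2)` of `b`, and the last use
produces the limit. -/
theorem tendsto_of_convolution_recursion {c : ℝ}
    (hb : Tendsto (fun n : ℕ => (n : ℝ) ^ (3 / 2 : ℝ) * b n) atTop (𝓝 c))
    (hs : ∀ n : ℕ, (n : ℝ) * s n = ∑ p ∈ antidiagonal n, b p.1 * s p.2) :
    Tendsto (fun n : ℕ => (n : ℝ) ^ (5 / 2 : ℝ) * s n) atTop (𝓝 (c * ∑' k, s k)) := by
  have hbs := summable_of_tendsto_rpow_mul (by norm_num) hb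
  have hss := summable_of_convolution_recursion hbs hs
  have step : ∀ {α β : ℝ} {U V : ℝ}, 0 ≤ α → α + 1 = β →
      Tendsto (fun n : ℕ => (n : ℝ) ^ α * b n) atTop (𝓝 U) →
      Tendsto (fun n : ℕ => (n : ℝ) ^ α * s n) atTop (𝓝 V) →
      Tendsto (fun n : ℕ => (n : ℝ) ^ β * s n) atTop (𝓝 (V * ∑' k, b k + U * ∑' k, s k)) := by
    intro α β U V hα hβ h1 h2
    refine (tendsto_rpow_mul_convolution hα hbs hss h1 h2).congr fun n => ?_
    rw [← hs n, ← mul_assoc, ← hβ]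
    rcases Nat.eq_zero_or_pos n with rfl | hn
    · have : α + 1 ≠ 0 := by linarith
      simp [Real.zero_rpow this]
    · rw [Real.rpow_add_one (by positivity)]
  have s0 : Tendsto (fun n : ℕ => (n : ℝ) ^ (0 : ℝ) * s n) atTop (𝓝 0) := by
    simpa using hss.tendsto_atTop_zero
  have s1 := step le_rfl (zero_add 1)
    (tendsto_rpow_mul_zero_of_lt (by norm_num : (0 : ℝ) < 3 / 2) hb) s0
  simp only [zero_mul, add_zero] at s1
  have s2 := step zero_le_one rfl (tendsto_rpow_mul_zero_of_lt (by norm_num) hb) s1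
  simp only [zero_mul, add_zero] at s2
  have s3 := step (by norm_num) (by norm_num : (3 / 2 : ℝ) + 1 = 5 / 2) hb
    (tendsto_rpow_mul_zero_of_lt (by norm_num) s2)
  simpa using s3

theorem hasDerivAt_tsum_pow {a : ℕ → ℝ} (ha : Summable fun n : ℕ => (n : ℝ) * a n) {x : ℝ}
    (hx : |x| < 1) :
    HasDerivAt (fun y => ∑' n, a n * y ^ n) (∑' n : ℕ, ((n + 1 : ℕ) : ℝ) * a (n + 1) * x ^ n) x := by
  have h := hasDerivAt_tsum_of_isPreconnected (u := fun n : ℕ => |(n : ℝ) * a n|)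
    (g := fun n y => a n * y ^ n) (g' := fun n y => a n * (n * y ^ (n - 1)))
    (t := Metric.ball (0 : ℝ) 1) (y₀ := 0) (y := x) ha.abs Metric.isOpen_ball
    (convex_ball 0 1).isPreconnected
    (fun n y _ => (hasDerivAt_pow n y).const_mul (a n))
    (fun n y hy => by
      have hy' : |y| ≤ 1 := by simpa using (mem_ball_zero_iff.1 hy).le
      rw [Real.norm_eq_abs, ← mul_assoc, mul_comm (a n), abs_mul _ (y ^ _), abs_pow]
      exact mul_le_of_le_one_right (abs_nonneg _) (pow_le_one₀ (abs_nonneg _) hy'))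
    (by simp)
    (summable_of_ne_finset_zero (s := {0}) (fun n hn => by
      rw [Finset.mem_singleton] at hn; simp [hn]))
    (by simpa using hx)
  have hsum : Summable fun n : ℕ => a n * ((n : ℝ) * x ^ (n - 1)) := by
    refine Summable.of_norm_bounded ha.abs fun n => ?_
    rw [Real.norm_eq_abs, ← mul_assoc, mul_comm (a n), abs_mul _ (x ^ _), abs_pow]
    exact mul_le_of_le_one_right (abs_nonneg _) (pow_le_one₀ (abs_nonneg _) hx.le)
  rw [hsum.tsum_eq_zero_add] at h
  refine h.congr_deriv ?_
  simp only [Nat.cast_zero, zero_mul, mul_zero, zero_add, Nat.add_sub_cancel]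
  exact tsum_congr fun n => by push_cast; ring

theorem continuousOn_tsum_pow {a : ℕ → ℝ} (ha : Summable a) :
    ContinuousOn (fun y => ∑' n, a n * y ^ n) (Set.Icc (0 : ℝ) 1) := by
  refine continuousOn_tsum (u := fun n => |a n|) (fun n => by fun_prop) ha.abs ?_
  intro n y hy
  rw [Real.norm_eq_abs, abs_mul, abs_pow, abs_of_nonneg hy.1]
  exact mul_le_of_le_one_right (abs_nonneg _) (pow_le_one₀ hy.1 hy.2)

theorem summable_mul_pow {a : ℕ → ℝ} (ha : Summable a) {x : ℝ} (hx : |x| ≤ 1) :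
    Summable fun n => a n * x ^ n := by
  refine Summable.of_norm_bounded ha.abs fun n => ?_
  rw [Real.norm_eq_abs, abs_mul, abs_pow]
  exact mul_le_of_le_one_right (abs_nonneg _) (pow_le_one₀ (abs_nonneg _) hx)

/-- If `x s'(x) = x a'(x) s(x)` for power series with `b n = n a n`, then
`s(1) = s(0) exp (a(1))`. -/
theorem tsum_of_convolution_recursion {c : ℝ} (hb0 : b 0 = 0)
    (hb : Tendsto (fun n : ℕ => (n : ℝ) ^ (3 / 2 : ℝ) * b n) atTop (𝓝 c))
    (hs : ∀ n : ℕ, (n : ℝ) * s n = ∑ p ∈ antidiagonal n, b p.1 * s p.2) :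
    ∑' n, s n = s 0 * Real.exp (∑' n : ℕ, b n / n) := by
  have hbs := summable_of_tendsto_rpow_mul (by norm_num) hb
  have hss := summable_of_convolution_recursion hbs hs
  have hss' : Summable fun n : ℕ => (n : ℝ) * s n := by
    simp only [hs]
    have := (summable_norm_sum_mul_antidiagonal_of_summable_norm hbs.norm hss.norm)
    exact this.of_norm
  have hba : ∀ n : ℕ, (n : ℝ) * (b n / n) = b n := fun n => by
    rcases Nat.eq_zero_or_pos n with rfl | hn
    · simp [hb0]
    · field_simp
  have has' : Summable fun n : ℕ => (n : ℝ) * (b n / n) := by simpa only [hba] using hbs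
  have has : Summable fun n : ℕ => b n / n := by
    refine Summable.of_norm_bounded hbs.abs fun n => ?_
    rcases Nat.eq_zero_or_pos n with rfl | hn
    · simp
    · rw [norm_div, Real.norm_natCast]
      exact div_le_self (abs_nonneg _) (by exact_mod_cast hn)
  set F : ℝ → ℝ := fun y => ∑' n, s n * y ^ n with hF
  set G : ℝ → ℝ := fun y => ∑' n : ℕ, (b n / n) * y ^ n with hG
  -- `F exp (-G)` has zero derivative on `[0, 1)` since `F' = G' F`; continuity on `[0, 1]` carries
  -- constancy to the endpoint, where the series are the required sums.
  have hconst := constant_of_has_deriv_right_zero (a := 0) (b := 1)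
    (f := fun y => F y * Real.exp (-G y))
    ((continuousOn_tsum_pow hss).mul (continuousOn_tsum_pow has).neg.rexp) (by
      intro x hx
      have hx' : |x| < 1 := by rw [abs_of_nonneg hx.1]; exact hx.2
      have hFd := hasDerivAt_tsum_pow hss' hx'
      have hGd := hasDerivAt_tsum_pow has' hx'
      have := hFd.mul hGd.neg.exp
      refine (this.congr_deriv ?_).hasDerivWithinAt
      -- The coefficient of `x ^ n` is the recursion at `n + 1`; its extra term vanishes because `b
      -- 0 = 0`.
      have e1 : ∑' n : ℕ, ((n + 1 : ℕ) : ℝ) * s (n + 1) * x ^ n =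
          (∑' n : ℕ, ((n + 1 : ℕ) : ℝ) * (b (n + 1) / (n + 1 : ℕ)) * x ^ n) *
            ∑' n, s n * x ^ n := by
        simp only [hba]
        rw [tsum_mul_tsum_eq_tsum_sum_antidiagonal_of_summable_norm
          (summable_mul_pow ((summable_nat_add_iff 1).2 hbs) hx'.le).norm
          (summable_mul_pow hss hx'.le).norm]
        refine tsum_congr fun n => ?_
        rw [hs, Finset.Nat.antidiagonal_succ, Finset.sum_cons, Finset.sum_map, hb0, zero_mul,
          zero_add, Finset.sum_mul]
        refine Finset.sum_congr rfl fun p hp => ?_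
        rw [← mem_antidiagonal.1 hp, pow_add]
        simp
        ring
      rw [e1]
      ring)
  have h1 := hconst 1 (by simp)
  have F0 : F 0 = s 0 := by
    simp only [hF]
    rw [tsum_eq_single 0 (fun n hn => by simp [hn])]; simp
  have G0 : G 0 = 0 := by
    simp only [hG]
    rw [tsum_eq_single 0 (fun n hn => by simp [hn])]; simp
  have F1 : F 1 = ∑' n, s n := by simp [hF]
  have G1 : G 1 = ∑' n : ℕ, b n / n := by simp [hG]
  simp only [F0, G0, F1, G1, neg_zero, Real.exp_zero, mul_one] at h1
  rw [← h1, mul_assoc, ← Real.exp_add]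
  simp

end Recursion

/-! ### Subset sums modulo `n` by a roots-of-unity filter. -/

section Equidistribution

open Finset Polynomial

/-- Complementation in `range (2 * n)` preserves size and divisibility, the total being `n (2n -
1)`, and exchanges the sets containing 0 with those avoiding it, which are the sets counted by `N
n`. Including 0 makes the ground set two full periods modulo `n`. -/
theorem card_powersetCard_range_dvd_sum {n : ℕ} (hn : 0 < n) :
    #{A ∈ (range (2 * n)).powersetCard n | n ∣ ∑ a ∈ A, a} = 2 * N n := by
  classical
  have hsum : ∀ A ⊆ range (2 * n), (∑ a ∈ range (2 * n) \ A, a) + ∑ a ∈ A, a =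
      n * (2 * n - 1) := fun A hA => by
    rw [Finset.sum_sdiff hA, Finset.sum_range_id, mul_assoc, Nat.mul_div_cancel_left _ two_pos]
  have h0 : N n = #{A ∈ {A ∈ (range (2 * n)).powersetCard n | n ∣ ∑ a ∈ A, a} | 0 ∉ A} := by
    unfold N
    congr 1
    ext A
    simp only [mem_filter, mem_powersetCard]
    constructor
    · rintro ⟨⟨h1, h2⟩, h3⟩
      refine ⟨⟨⟨fun a ha => ?_, h2⟩, h3⟩, fun h => ?_⟩
      · have := mem_Icc.1 (h1 ha)
        rw [mem_range]; omega
      · have := mem_Icc.1 (h1 h)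
        omega
    · rintro ⟨⟨⟨h1, h2⟩, h3⟩, h4⟩
      refine ⟨⟨fun a ha => ?_, h2⟩, h3⟩
      have := mem_range.1 (h1 ha)
      have : a ≠ 0 := by rintro rfl; exact h4 ha
      rw [mem_Icc]; omega
  have hcompl : ∀ A ∈ {A ∈ (range (2 * n)).powersetCard n | n ∣ ∑ a ∈ A, a},
      range (2 * n) \ A ∈ {A ∈ (range (2 * n)).powersetCard n | n ∣ ∑ a ∈ A, a} := by
    intro A hA
    simp only [mem_filter, mem_powersetCard] at hA ⊢
    obtain ⟨⟨h1, h2⟩, h3⟩ := hA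
    refine ⟨⟨sdiff_subset, ?_⟩, ?_⟩
    · rw [card_sdiff_of_subset h1, card_range, h2]; omega
    · rw [← Nat.dvd_add_left h3, hsum A h1]
      exact dvd_mul_right _ _
  have h1 : #{A ∈ {A ∈ (range (2 * n)).powersetCard n | n ∣ ∑ a ∈ A, a} | 0 ∈ A} =
      #{A ∈ {A ∈ (range (2 * n)).powersetCard n | n ∣ ∑ a ∈ A, a} | 0 ∉ A} := by
    refine Finset.card_bij' (fun A _ => range (2 * n) \ A) (fun A _ => range (2 * n) \ A)
      ?_ ?_ ?_ ?_
    · intro A hA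
      rw [mem_filter] at hA ⊢
      exact ⟨hcompl A hA.1, fun h => (mem_sdiff.1 h).2 hA.2⟩
    · intro A hA
      rw [mem_filter] at hA ⊢
      exact ⟨hcompl A hA.1, mem_sdiff.2 ⟨mem_range.2 (by omega), hA.2⟩⟩
    all_goals
      intro A hA
      have := (mem_powersetCard.1 (mem_filter.1 (mem_filter.1 hA).1).1).1
      exact Finset.sdiff_sdiff_eq_self this
  rw [← card_filter_add_card_filter_not (p := fun A => 0 ∈ A), h1, ← h0]
  omega

theorem IsPrimitiveRoot.prod_range_X_sub_C {K : Type*} [Field K] {q : K} {e : ℕ} (he : 0 < e)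
    (hq : IsPrimitiveRoot q e) : ∏ i ∈ range e, (X - C (q ^ i)) = (X ^ e - 1 : K[X]) := by
  classical
  have : NeZero e := ⟨he.ne'⟩
  rw [X_pow_sub_one_eq_prod he hq]
  have : nthRootsFinset e (1 : K) = (range e).image (q ^ ·) := by
    ext x
    rw [mem_nthRootsFinset he, mem_image]
    constructor
    · intro hx
      obtain ⟨i, hi, rfl⟩ := hq.eq_pow_of_pow_eq_one hx
      exact ⟨i, mem_range.2 hi, rfl⟩
    · rintro ⟨i, -, rfl⟩
      rw [← pow_mul, mul_comm, pow_mul, hq.pow_eq_one, one_pow]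
  rw [this, prod_image]
  intro i hi j hj h
  exact hq.pow_inj (mem_range.1 hi) (mem_range.1 hj) h

theorem IsPrimitiveRoot.prod_range_mul_X_sub_C {K : Type*} [Field K] {q : K} {e : ℕ} (he : 0 < e)
    (hq : IsPrimitiveRoot q e) (m : ℕ) :
    ∏ i ∈ range (e * m), (X - C (q ^ i)) = ((X ^ e - 1) ^ m : K[X]) := by
  induction m with
  | zero => simp
  | succ m ih =>
    rw [mul_add, mul_one, prod_range_add, ih, pow_succ, ← IsPrimitiveRoot.prod_range_X_sub_C he hq]
    congr 1
    refine prod_congr rfl fun i _ => ?_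
    rw [pow_add, pow_mul, hq.pow_eq_one, one_pow, one_mul]

theorem norm_coeff_X_pow_sub_one_pow_le (e m k : ℕ) (he : 0 < e) :
    ‖((X ^ e - 1) ^ m : ℂ[X]).coeff k‖ ≤ 2 ^ m := by
  have : ((X ^ e - 1) ^ m : ℂ[X]) = expand ℂ e ((X + C (-1)) ^ m) := by simp [sub_eq_add_neg]
  rw [this, coeff_expand he]
  split_ifs
  · rw [coeff_X_add_C_pow, norm_mul, norm_pow, norm_neg, norm_one, one_pow, one_mul,
      Complex.norm_natCast]
    exact_mod_cast Nat.choose_le_two_pow _ _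
  · simp

/-- The sum is an elementary symmetric function of the powers of `q`, hence up to sign a coefficient
of `(X ^ e - 1) ^ (2 * d)` with `e` the order of `q` and `n = e * d`. Since `q ≠ 1`, `e ≥ 2` and `2
* d ≤ n`. -/
theorem norm_sum_powersetCard_pow_sum_le {n : ℕ} (hn : 0 < n) {q : ℂ} (hq : q ^ n = 1)
    (hq1 : q ≠ 1) : ‖∑ A ∈ (range (2 * n)).powersetCard n, q ^ ∑ a ∈ A, a‖ ≤ 2 ^ n := by
  set e := orderOf q with he
  have hprim : IsPrimitiveRoot q e := IsPrimitiveRoot.orderOf q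
  obtain ⟨d, hd⟩ : e ∣ n := orderOf_dvd_of_pow_eq_one hq
  have he0 : 0 < e := Nat.pos_of_ne_zero (by rintro h; simp [h] at hd; omega)
  have he1 : e ≠ 1 := fun h => hq1 (orderOf_eq_one_iff.1 h)
  have h1 := IsPrimitiveRoot.prod_range_mul_X_sub_C he0 hprim (2 * d)
  have h2 : e * (2 * d) = 2 * n := by rw [hd]; ring
  rw [h2] at h1
  have h3 := Multiset.prod_X_sub_C_coeff ((range (2 * n)).val.map fun i => q ^ i) (k := n)
    (by simp; omega)
  have h4 : 2 * n - n = n := by omega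
  simp only [Multiset.map_map, Multiset.card_map, card_val, card_range, h4] at h3
  have h5 : ((range (2 * n)).val.map fun i => q ^ i).esymm n =
      ∑ A ∈ (range (2 * n)).powersetCard n, q ^ ∑ a ∈ A, a := by
    rw [Finset.esymm_map_val]
    exact sum_congr rfl fun A _ => (prod_pow_eq_pow_sum A _ q)
  have h6 : (Multiset.map ((fun t : ℂ => X - C t) ∘ fun i => q ^ i) (range (2 * n)).val).prod =
      ∏ i ∈ range (2 * n), (X - C (q ^ i)) := rfl
  rw [h6, h1, h5] at h3
  have h7 := norm_coeff_X_pow_sub_one_pow_le e (2 * d) n he0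
  rw [h3, norm_mul, norm_pow, norm_neg, norm_one, one_pow, one_mul] at h7
  refine h7.trans (pow_le_pow_right₀ one_le_two ?_)
  rw [hd]
  exact Nat.mul_le_mul_right _ (by omega)

theorem IsPrimitiveRoot.sum_pow_pow {K : Type*} [Field K] {ζ : K} {n : ℕ}
    (hζ : IsPrimitiveRoot ζ n) (m : ℕ) :
    ∑ j ∈ range n, (ζ ^ j) ^ m = if n ∣ m then (n : K) else 0 := by
  have h : ∀ j, (ζ ^ j) ^ m = (ζ ^ m) ^ j := fun j => by rw [← pow_mul, ← pow_mul, mul_comm]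
  simp only [h]
  split_ifs with hd
  · simp [(hζ.pow_eq_one_iff_dvd m).2 hd]
  · have h1 : ζ ^ m ≠ 1 := fun h => hd ((hζ.pow_eq_one_iff_dvd m).1 h)
    rw [geom_sum_eq h1, ← pow_mul, mul_comm, pow_mul, hζ.pow_eq_one, one_pow, sub_self, zero_div]

/-- In the filter over the `n`-th roots of unity, the root 1 contributes the central binomial
coefficient and every other root at most `2 ^ n`. -/
theorem abs_two_mul_N_sub_centralBinom_le {n : ℕ} (hn : 0 < n) :
    |(n : ℝ) * (2 * N n) - n.centralBinom| ≤ n * 2 ^ n := by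
  have hζ := Complex.isPrimitiveRoot_exp n hn.ne'
  set ζ := Complex.exp (2 * Real.pi * Complex.I / n)
  have h1 : ((n : ℂ) * (2 * N n)) =
      ∑ j ∈ range n, ∑ A ∈ (range (2 * n)).powersetCard n, (ζ ^ j) ^ ∑ a ∈ A, a := by
    rw [Finset.sum_comm]
    simp only [IsPrimitiveRoot.sum_pow_pow hζ]
    rw [← Finset.sum_filter, Finset.sum_const, card_powersetCard_range_dvd_sum hn]
    simp; ring
  have h2 : ((n : ℂ) * (2 * N n)) - n.centralBinom =
      ∑ j ∈ (range n).erase 0,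
        ∑ A ∈ (range (2 * n)).powersetCard n, (ζ ^ j) ^ ∑ a ∈ A, a := by
    rw [h1, ← Finset.add_sum_erase _ _ (mem_range.2 hn)]
    simp [Nat.centralBinom]
  have h3 : ‖((n : ℂ) * (2 * N n)) - n.centralBinom‖ ≤ n * 2 ^ n := by
    rw [h2]
    refine (norm_sum_le_of_le _ (f := _) (n := fun _ => (2 : ℝ) ^ n) fun j hj => ?_).trans ?_
    · rw [mem_erase, mem_range] at hj
      refine norm_sum_powersetCard_pow_sum_le hn ?_ ?_
      · rw [← pow_mul, mul_comm, pow_mul, hζ.pow_eq_one, one_pow]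
      · exact hζ.pow_ne_one_of_pos_of_lt hj.1 hj.2
    · rw [sum_const, nsmul_eq_mul]
      gcongr
      calc #((range n).erase 0) ≤ #(range n) := card_erase_le
        _ = n := card_range n
  rw [← Real.norm_eq_abs, ← Complex.norm_real]
  push_cast
  exact h3

end Equidistribution

/-! ### Asymptotics of `N n` from Stirling's formula. -/

section Asymptotics

theorem tendsto_sqrt_mul_centralBinom_div :
    Tendsto (fun n : ℕ => Real.sqrt n * n.centralBinom / 4 ^ n) atTop (𝓝 (1 / Real.sqrt Real.pi)) := by
  have h := Stirling.tendsto_stirlingSeq_sqrt_pi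
  have h2 : Tendsto (fun n : ℕ => Stirling.stirlingSeq (2 * n)) atTop (𝓝 (Real.sqrt Real.pi)) :=
    h.comp (tendsto_id.const_mul_atTop' two_pos)
  have hπ : Real.sqrt Real.pi ≠ 0 := by positivity
  have h3 := h2.div (h.pow 2) (pow_ne_zero 2 hπ)
  have e : Real.sqrt Real.pi / Real.sqrt Real.pi ^ 2 = 1 / Real.sqrt Real.pi := by
    field_simp
  rw [e] at h3
  refine h3.congr' ?_
  filter_upwards [eventually_gt_atTop 0] with n hn
  have hn' : (0 : ℝ) < n := by exact_mod_cast hn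
  have hc : (n.centralBinom : ℝ) = ((2 * n).factorial : ℝ) / ((n.factorial : ℝ) ^ 2) := by
    rw [Nat.centralBinom_eq_two_mul_choose, Nat.cast_choose ℝ (by omega : n ≤ 2 * n)]
    have : 2 * n - n = n := by omega
    rw [this, sq]
  have hf : (n.factorial : ℝ) ≠ 0 := by exact_mod_cast n.factorial_ne_zero
  have s1 : Real.sqrt (2 * ((2 * n : ℕ) : ℝ)) = 2 * Real.sqrt n := by
    rw [show (2 * ((2 * n : ℕ) : ℝ)) = 2 ^ 2 * n by push_cast; ring,
      Real.sqrt_mul (by norm_num), Real.sqrt_sq (by norm_num)]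
  have s2 : Real.sqrt (2 * (n : ℝ)) ^ 2 = 2 * n := Real.sq_sqrt (by positivity)
  have s3 : Real.sqrt (n : ℝ) ^ 2 = n := Real.sq_sqrt (by positivity)
  have s4 : (((2 * n : ℕ) : ℝ) / Real.exp 1) ^ (2 * n) = 4 ^ n * ((n / Real.exp 1) ^ n) ^ 2 := by
    rw [← pow_mul, mul_comm n 2, show (4 : ℝ) ^ n = 2 ^ (2 * n) by rw [pow_mul]; norm_num,
      ← mul_pow]
    congr 1; push_cast; ring
  have hs : Real.sqrt (n : ℝ) ≠ 0 := by positivity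
  simp only [Pi.div_apply, Stirling.stirlingSeq]
  rw [s1, s4, hc, div_pow (n.factorial : ℝ), mul_pow (Real.sqrt _), s2]
  have : ((n : ℝ) / Real.exp 1) ^ n ≠ 0 := by positivity
  generalize ((n : ℝ) / Real.exp 1) ^ n = E at *
  field_simp
  rw [s3]

theorem tendsto_rpow_mul_N_div :
    Tendsto (fun n : ℕ => (n : ℝ) ^ (3 / 2 : ℝ) * (N n / 4 ^ n)) atTop
      (𝓝 (1 / (2 * Real.sqrt Real.pi))) := by
  have h1 := tendsto_sqrt_mul_centralBinom_div.div_const 2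
  have h2 : Tendsto (fun n : ℕ => (n : ℝ) ^ 2 * (1 / 2 : ℝ) ^ n) atTop (𝓝 0) :=
    tendsto_pow_const_mul_const_pow_of_abs_lt_one 2 (by norm_num [abs_lt])
  have h3 : Tendsto (fun n : ℕ => (n : ℝ) ^ (3 / 2 : ℝ) * (N n / 4 ^ n) -
      Real.sqrt n * n.centralBinom / 4 ^ n / 2) atTop (𝓝 0) := by
    refine squeeze_zero_norm' ?_ h2
    filter_upwards [eventually_gt_atTop 0] with n hn
    have hn' : (0 : ℝ) < n := by exact_mod_cast hn
    have hn1 : (1 : ℝ) ≤ n := by exact_mod_cast hn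
    have e1 : (n : ℝ) ^ (3 / 2 : ℝ) = Real.sqrt n * n := by
      rw [Real.sqrt_eq_rpow, ← Real.rpow_add_one hn'.ne']; norm_num
    have e2 : (n : ℝ) ^ (3 / 2 : ℝ) * (N n / 4 ^ n) - Real.sqrt n * n.centralBinom / 4 ^ n / 2 =
        Real.sqrt n / (2 * 4 ^ n) * ((n : ℝ) * (2 * N n) - n.centralBinom) := by
      rw [e1]; field_simp
    have e3 : (4 : ℝ) ^ n = 2 ^ n * 2 ^ n := by rw [← mul_pow]; norm_num
    have e4 : Real.sqrt n ≤ n := by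
      rw [Real.sqrt_le_left hn'.le]; nlinarith
    rw [e2, norm_mul, Real.norm_eq_abs, Real.norm_eq_abs, abs_of_nonneg (by positivity)]
    calc Real.sqrt n / (2 * 4 ^ n) * |(n : ℝ) * (2 * N n) - n.centralBinom|
        ≤ n / (1 * 4 ^ n) * (n * 2 ^ n) := by
          gcongr
          · norm_num
          · exact abs_two_mul_N_sub_centralBinom_le hn
      _ = n ^ 2 * (1 / 2) ^ n := by
          rw [e3, div_pow, one_pow]; field_simp
  have h4 := h3.add h1
  simp only [sub_add_cancel, zero_add] at h4
  convert h4 using 2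
  field_simp

end Asymptotics

/-! ### Convergence in distribution on `ℕ` and the laws involved. -/

section Probability

/-- Pointwise convergence of the probability mass functions implies convergence in distribution. -/
theorem tendstoInDistribution_of_tendsto_measure_eq {Ω : ℕ → Type*} [∀ n, MeasurableSpace (Ω n)]
    {P : ∀ n, Measure (Ω n)} [∀ n, IsProbabilityMeasure (P n)] {Ω' : Type*} [MeasurableSpace Ω']
    {P' : Measure Ω'} [IsProbabilityMeasure P'] {X : ∀ n, Ω n → ℕ} {Z : Ω' → ℕ}
    (hX : ∀ n, AEMeasurable (X n) (P n)) (hZ : AEMeasurable Z P')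
    (h : ∀ m, Tendsto (fun n => P n {ω | X n ω = m}) atTop (𝓝 (P' {ω | Z ω = m}))) :
    TendstoInDistribution X atTop Z P P' := by
  -- The portmanteau bound for `G` is Fatou's lemma for counting measure applied to the mass
  -- functions restricted to `G`.
  refine ⟨hX, hZ, tendsto_of_forall_isOpen_le_liminf' fun G _ => ?_⟩
  simp only [ProbabilityMeasure.coe_mk]
  have hcount : ∀ μ : Measure ℕ, μ G = ∫⁻ k, G.indicator (fun x => μ {x}) k ∂Measure.count :=
    fun μ => by rw [lintegral_count, Measure.tsum_indicator_apply_singleton _ _ .of_discrete]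
  have hlim : ∀ k, G.indicator (fun x => P'.map Z {x}) k =
      liminf (fun n => G.indicator (fun x => (P n).map (X n) {x}) k) atTop := fun k => by
    refine (Tendsto.liminf_eq ?_).symm
    by_cases hk : k ∈ G
    · simp only [Set.indicator_of_mem hk]
      have h1 := h k
      rw [Measure.map_apply_of_aemeasurable hZ (measurableSet_singleton k)]
      simp_rw [fun n => Measure.map_apply_of_aemeasurable (hX n) (measurableSet_singleton k)]
      exact h1
    · simp only [Set.indicator_of_notMem hk]
      exact tendsto_const_nhds
  rw [hcount]
  simp_rw [hcount (Measure.map _ _), hlim]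
  exact lintegral_liminf_le fun _ => Measurable.of_discrete

theorem negBinomialMeasure_singleton (r : ℕ) (p : ℝ) (k : ℕ) :
    negBinomialMeasure r p {k} =
      ENNReal.ofReal (((k + r - 1).choose k : ℝ) * (1 - p) ^ k * p ^ r) := by
  unfold negBinomialMeasure
  rw [Measure.sum_apply _ (measurableSet_singleton k), tsum_eq_single k]
  · simp
  · intro j hj
    simp [hj]

theorem measureReal_eq_of_hasLaw_negBinomial {Ω' : Type*} [MeasurableSpace Ω'] {P' : Measure Ω'}
    {Z : Ω' → ℕ} {p : ℝ} (hp1 : p ≤ 1)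
    (hZ : HasLaw Z (negBinomialMeasure 2 p) P') (k : ℕ) :
    P'.real {ω | Z ω = k} = (k + 1) * (1 - p) ^ k * p ^ 2 := by
  have h := hZ.measure_eq (p := fun x => x = k) (measurableSet_singleton k)
  have h1 : (k + 2 - 1).choose k = k + 1 := by
    rw [show k + 2 - 1 = k + 1 by omega, Nat.choose_succ_self_right]
  have h2 : {x : ℕ | x = k} = {k} := rfl
  rw [h2, negBinomialMeasure_singleton, h1] at h
  have : 0 ≤ 1 - p := by linarith
  rw [Measure.real, h, ENNReal.toReal_ofReal (by positivity)]
  push_cast; ring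

instance (n : ℕ) : Finite (Tournament n) :=
  Finite.of_injective (fun T : Tournament n => T.beats) fun T T' h => by
    cases T; cases T'; congr

theorem finite_scoreSequences (n : ℕ) : (scoreSequences n).Finite := Set.finite_range _

theorem measureReal_numIrreducible_eq {n : ℕ} {Ω : Type*} [MeasurableSpace Ω] {P : Measure Ω}
    {s : Ω → (Fin n → ℕ)} (hs : HasLaw s (uniformOn (scoreSequences n)) P) (m : ℕ) :
    P.real {ω | numIrreducible (s ω) = m} = (Sirr n m : ℝ) / (S n : ℝ) := by
  have hfin := finite_scoreSequences n
  have hcount : ∀ t : Set (Fin n → ℕ), t.Finite → Measure.count t = (t.ncard : ENNReal) :=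
    fun t ht => by rw [Measure.count_apply_finite t ht, Set.ncard_eq_toFinset_card t ht]
  have h := hs.measure_eq (p := fun x => numIrreducible x = m) (Set.to_countable _).measurableSet
  rw [uniformOn, cond_apply hfin.measurableSet, hcount _ hfin,
    hcount _ (hfin.subset Set.inter_subset_left)] at h
  rw [Measure.real, h, ENNReal.toReal_mul, ENNReal.toReal_inv, ENNReal.toReal_natCast,
    ENNReal.toReal_natCast, mul_comm, ← div_eq_mul_inv]
  rfl

end Probability

/-! ### Partial sums of finite sequences. -/

section PartialSums

/-- The sum of the first `k` entries of `f`. -/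
def psum {n : ℕ} (f : Fin n → ℕ) (k : ℕ) : ℕ := ∑ i : Fin n with i.val < k, f i

variable {n : ℕ} (f : Fin n → ℕ)

@[simp] theorem psum_zero : psum f 0 = 0 := by simp [psum]

theorem psum_succ (i : Fin n) : psum f (i + 1) = psum f i + f i := by
  have : ({j : Fin n | j.val < i + 1} : Finset (Fin n)) =
      insert i ({j : Fin n | j.val < i} : Finset (Fin n)) := by
    ext j
    simp only [Finset.mem_filter, Finset.mem_univ, true_and, Finset.mem_insert, Fin.ext_iff]
    omega
  rw [psum, this, Finset.sum_insert (by simp), add_comm]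
  rfl

theorem psum_of_le {k : ℕ} (hk : n ≤ k) : psum f k = ∑ i, f i := by
  rw [psum, Finset.filter_true_of_mem fun i _ => i.2.trans_le hk]

/-- The element of `A` with index `j` in increasing order, counted from 0, is at least `j`. -/
theorem psum_le_sum_of_card_eq {f : Fin n → ℕ} (hf : Monotone f) (A : Finset (Fin n)) :
    psum f A.card ≤ ∑ i ∈ A, f i := by
  have hcard : A.card ≤ n := by simpa using A.card_le_univ
  have h1 : psum f A.card = ∑ i : Fin A.card, f (Fin.castLE hcard i) := by
    refine (Finset.sum_bij (fun i _ => Fin.castLE hcard i) ?_ ?_ ?_ ?_).symm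
    · intro i _; simp
    · intro i _ j _ h; simpa [Fin.ext_iff] using h
    · intro i hi
      exact ⟨⟨i, (Finset.mem_filter.1 hi).2⟩, Finset.mem_univ _, rfl⟩
    · intro i _; rfl
  have h2 : ∑ i ∈ A, f i = ∑ i : Fin A.card, f (A.orderEmbOfFin rfl i) := by
    conv_lhs => rw [← Finset.map_orderEmbOfFin_univ A rfl]
    rw [Finset.sum_map]
    rfl
  rw [h1, h2]
  refine Finset.sum_le_sum fun i _ => hf ?_
  have key : ∀ j (hj : j < A.card), j ≤ (A.orderEmbOfFin rfl ⟨j, hj⟩).val := by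
    intro j
    induction j with
    | zero => intro _; exact Nat.zero_le _
    | succ j ih =>
      intro hj
      have h3 := ih (by omega)
      have h4 : A.orderEmbOfFin rfl ⟨j, by omega⟩ < A.orderEmbOfFin rfl ⟨j + 1, hj⟩ :=
        (A.orderEmbOfFin rfl).strictMono (by simp)
      have h5 : (A.orderEmbOfFin rfl ⟨j, by omega⟩).val <
        (A.orderEmbOfFin rfl ⟨j + 1, hj⟩).val := h4
      omega
  exact key i i.2

end PartialSums

/-! ### Landau's theorem. -/

section Landau

/-- Landau's conditions for a sequence to be a score sequence. -/
structure IsLandau {n : ℕ} (f : Fin n → ℕ) : Prop where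
  monotone : Monotone f
  choose_two_le : ∀ k ≤ n, k.choose 2 ≤ psum f k
  psum_eq : psum f n = n.choose 2

variable {n : ℕ}

open scoped Classical in
theorem Tournament.sum_card_beats_eq (T : Tournament n) (A : Finset (Fin n)) :
    ∑ i ∈ A, (A.filter (T.beats i)).card = A.card.choose 2 := by
  have h1 : ∑ i ∈ A, (A.filter (T.beats i)).card = ∑ i ∈ A, (A.filter fun j => T.beats j i).card :=
    Finset.sum_card_bipartiteAbove_eq_sum_card_bipartiteBelow T.beats
  have h2 : ∑ i ∈ A, (A.filter (T.beats i)).card + ∑ i ∈ A, (A.filter fun j => T.beats j i).card =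
      A.card * (A.card - 1) := by
    rw [← Finset.sum_add_distrib, ← smul_eq_mul, ← Finset.sum_const]
    refine Finset.sum_congr rfl fun i hi => ?_
    rw [← Finset.card_erase_of_mem hi, ← Finset.card_union_of_disjoint]
    · congr 1
      ext j
      simp only [Finset.mem_union, Finset.mem_filter, Finset.mem_erase]
      constructor
      · rintro (⟨h, h'⟩ | ⟨h, h'⟩)
        · exact ⟨fun e => T.not_beats_self i (e ▸ h'), h⟩
        · exact ⟨fun e => T.not_beats_self i (e ▸ h'), h⟩
      · rintro ⟨h, h'⟩
        by_cases hb : T.beats j i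
        · exact Or.inr ⟨h', hb⟩
        · exact Or.inl ⟨h', (T.beats_iff i j (Ne.symm h)).2 hb⟩
    · rw [Finset.disjoint_left]
      intro j hj hj'
      rw [Finset.mem_filter] at hj hj'
      have hne : i ≠ j := fun e => T.not_beats_self i (by simpa [← e] using hj.2)
      exact (T.beats_iff i j hne).1 hj.2 hj'.2
  rw [Nat.choose_two_right, ← h2, ← h1, ← two_mul, Nat.mul_div_cancel_left _ two_pos]

open scoped Classical in
theorem Tournament.score_eq_card (T : Tournament n) (i : Fin n) :
    T.score i = (Finset.univ.filter (T.beats i)).card := by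
  rw [Tournament.score, ← Set.ncard_coe_finset]
  simp

theorem Tournament.choose_two_le_sum_score (T : Tournament n) (A : Finset (Fin n)) :
    A.card.choose 2 ≤ ∑ i ∈ A, T.score i := by
  classical
  rw [← T.sum_card_beats_eq A]
  refine Finset.sum_le_sum fun i _ => ?_
  rw [T.score_eq_card]
  exact Finset.card_le_card (Finset.filter_subset_filter _ (Finset.subset_univ _))

theorem Tournament.sum_score (T : Tournament n) : ∑ i, T.score i = n.choose 2 := by
  classical
  have := T.sum_card_beats_eq Finset.univ
  rw [Finset.card_univ, Fintype.card_fin] at this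
  rw [← this]
  exact Finset.sum_congr rfl fun i _ => T.score_eq_card i

theorem Tournament.isLandau_scoreSequence (T : Tournament n) : IsLandau T.scoreSequence where
  monotone := Tuple.monotone_sort T.score
  choose_two_le k hk := by
    have h1 : psum T.scoreSequence k = ∑ i ∈ ({j : Fin n | j.val < k} : Finset (Fin n)).map
        (Tuple.sort T.score).toEmbedding, T.score i := by
      rw [Finset.sum_map]; rfl
    have h2 : ({j : Fin n | j.val < k} : Finset (Fin n)).card = k := by
      rw [Fin.card_filter_val_lt, min_eq_right hk]
    have := T.choose_two_le_sum_score (({j : Fin n | j.val < k} : Finset (Fin n)).map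
        (Tuple.sort T.score).toEmbedding)
    rwa [Finset.card_map, h2, ← h1] at this
  psum_eq := by
    rw [psum_of_le _ le_rfl, ← T.sum_score]
    exact Equiv.sum_comp (Tuple.sort T.score) T.score

/-- **Landau's theorem**, sufficiency, from Hall's marriage theorem. -/
theorem IsLandau.exists_tournament {f : Fin n → ℕ} (hf : IsLandau f) :
    ∃ T : Tournament n, T.score = f := by
  classical
  let G := {e : Sym2 (Fin n) // ¬ e.IsDiag}
  -- Vertex `i` owns `f i` win slots, and a game may be assigned to a slot of either of its two
  -- players. For games `E` among the vertices `V`, Hall's condition reads `|E| ≤ |V|.choose 2 ≤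
  -- psum f |V| ≤ ∑ i ∈ V, f i`.
  let t : G → Finset (Σ i : Fin n, Fin (f i)) := fun e => {x | x.1 ∈ e.1}
  obtain ⟨w, hw, hwt⟩ := (Finset.all_card_le_biUnion_card_iff_exists_injective t).1 (by
    intro E
    set V : Finset (Fin n) := {i | ∃ e ∈ E, i ∈ e.1} with hV
    have h1 : E.biUnion t = V.sigma fun _ => Finset.univ := by
      ext x
      simp [t, hV]
    have h2 : E.card ≤ V.card.choose 2 := by
      rw [← Sym2.card_image_offDiag V, ← Finset.card_map (Function.Embedding.subtype _)]
      refine Finset.card_le_card fun e he => ?_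
      obtain ⟨⟨e', hd⟩, heE, rfl⟩ := Finset.mem_map.1 he
      induction e' using Sym2.ind with
      | _ a b =>
        rw [Finset.mem_image]
        refine ⟨(a, b), ?_, rfl⟩
        rw [Finset.mem_offDiag]
        simp only [hV, Finset.mem_filter, Finset.mem_univ, true_and]
        exact ⟨⟨_, heE, by simp⟩, ⟨_, heE, by simp⟩, fun h => hd (by simpa using h)⟩
    rw [h1, Finset.card_sigma]
    simp only [Finset.card_univ, Fintype.card_fin]
    refine h2.trans (le_trans ?_ (psum_le_sum_of_card_eq hf.monotone V))
    exact hf.choose_two_le _ (by simpa using V.card_le_univ))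
  have hmem : ∀ e : G, (w e).1 ∈ e.1 := fun e => by simpa [t] using hwt e
  let T : Tournament n :=
    { beats := fun i j => ∃ h : i ≠ j, (w ⟨s(i, j), by simpa using h⟩).1 = i
      not_beats_self := fun i ⟨h, _⟩ => h rfl
      beats_iff := by
        intro i j hij
        have h1 : (⟨s(j, i), by simpa using hij.symm⟩ : G) = ⟨s(i, j), by simpa using hij⟩ :=
          Subtype.ext Sym2.eq_swap
        have h2 := hmem ⟨s(i, j), by simpa using hij⟩
        rw [Sym2.mem_iff] at h2
        constructor
        · rintro ⟨_, h3⟩ ⟨_, h4⟩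
          rw [h1] at h4
          exact hij (h3.symm.trans h4)
        · intro h3
          refine ⟨hij, h2.resolve_right fun h4 => h3 ⟨hij.symm, ?_⟩⟩
          rw [h1]; exact h4 }
  refine ⟨T, ?_⟩
  -- Injectivity only bounds each score by the number of slots; equality of the totals then forces
  -- equality everywhere.
  have hle : ∀ i ∈ Finset.univ, T.score i ≤ f i := by
    intro i _
    rw [T.score_eq_card]
    have hc : (({i} : Finset (Fin n)).sigma fun i => (Finset.univ : Finset (Fin (f i)))).card =
        f i := by simp
    rw [← hc, ← Fintype.card_subtype, ← Fintype.card_coe]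
    refine Fintype.card_le_of_injective
      (fun j => ⟨w ⟨s(i, j.1), by simpa using j.2.1⟩, by simpa using j.2.2⟩) ?_
    intro j k hjk
    have h1 := congrArg Subtype.val (hw (congrArg Subtype.val hjk))
    have h2 : i ≠ j.1 := j.2.1
    exact Subtype.ext (by simpa [h2.symm] using h1)
  have hsum : ∑ i, T.score i = ∑ i, f i := by
    rw [T.sum_score, ← hf.psum_eq, psum_of_le _ le_rfl]
  funext i
  exact (Finset.sum_eq_sum_iff_of_le hle).1 hsum i (Finset.mem_univ i)

/-- **Landau's theorem.** -/
theorem mem_scoreSequences_iff {f : Fin n → ℕ} : f ∈ scoreSequences n ↔ IsLandau f := by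
  constructor
  · rintro ⟨T, rfl⟩
    exact T.isLandau_scoreSequence
  · intro hf
    obtain ⟨T, hT⟩ := hf.exists_tournament
    refine ⟨T, ?_⟩
    rw [Tournament.scoreSequence, hT, Tuple.sort_eq_refl_iff_monotone.2 hf.monotone]
    rfl

end Landau

/-! ### Score sequences as excess sequences. -/

section Excess

/-- Sequences of excesses `∑_{i ≤ k} s_i - (k choose 2)` of the partial sums of score sequences,
extended by zero. -/
structure IsExcess (n : ℕ) (d : ℕ → ℕ) : Prop where
  zero : d 0 = 0
  eq_zero : ∀ i, n ≤ i → d i = 0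
  -- The second difference of the partial sums is an increment of the scores, and that of `k.choose
  -- 2` is 1; so this is monotonicity of the scores.
  convex : ∀ i, 2 * d (i + 1) ≤ d (i + 2) + d i + 1

/-- The number of zeros of `d` among `1, …, n`. -/
def zeros (n : ℕ) (d : ℕ → ℕ) : ℕ := ∑ i ∈ Finset.range n, if d (i + 1) = 0 then 1 else 0

/-- The excesses of the partial sums of `f`. -/
def excess {n : ℕ} (f : Fin n → ℕ) (k : ℕ) : ℕ := psum f k - k.choose 2

theorem choose_two_succ (i : ℕ) : (i + 1).choose 2 = i.choose 2 + i := by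
  rw [Nat.choose_succ_succ' i 1, Nat.choose_one_right, add_comm]

variable {n : ℕ} {f : Fin n → ℕ} {d : ℕ → ℕ}

theorem IsLandau.isExcess (hf : IsLandau f) : IsExcess n (excess f) where
  zero := by simp [excess]
  eq_zero i hi := by
    have h1 : psum f i = n.choose 2 := by rw [← hf.psum_eq, psum_of_le _ hi, psum_of_le _ le_rfl]
    have h2 := Nat.choose_le_choose 2 hi
    rw [excess]; omega
  convex i := by
    by_cases hi : i + 2 ≤ n
    · have h0 := hf.choose_two_le i (by omega)
      have h1 := hf.choose_two_le (i + 1) (by omega)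
      have h2 := hf.choose_two_le (i + 2) (by omega)
      have e1 := psum_succ f ⟨i, by omega⟩
      have e2 := psum_succ f ⟨i + 1, by omega⟩
      have h3 : f ⟨i, by omega⟩ ≤ f ⟨i + 1, by omega⟩ := hf.monotone (by simp)
      have c1 := choose_two_succ i
      have c2 := choose_two_succ (i + 1)
      simp only [excess, add_assoc, Nat.reduceAdd] at *
      omega
    -- Here `n ≤ i + 1`, and truncated subtraction makes the middle excess 0.
    · have h1 : psum f (i + 1) = n.choose 2 := by
        rw [← hf.psum_eq, psum_of_le _ (by omega), psum_of_le _ le_rfl]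
      have h2 := Nat.choose_le_choose 2 (show n ≤ i + 1 by omega)
      rw [excess]; omega

/-- The first slope is nonnegative and slopes drop by at most 1 per step. This makes the subtraction
in the reconstructed score `d (i + 1) + i - d i` exact. -/
theorem IsExcess.le_succ_add (hd : IsExcess n d) (i : ℕ) : d i ≤ d (i + 1) + i := by
  induction i with
  | zero => simp [hd.zero]
  | succ i ih =>
    have := hd.convex i
    change d (i + 1) ≤ d (i + 2) + (i + 1)
    omega

theorem IsExcess.psum_eq (hd : IsExcess n d) {k : ℕ} (hk : k ≤ n) :
    psum (fun i : Fin n => d (i + 1) + i - d i) k = d k + k.choose 2 := by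
  induction k with
  | zero => simp [hd.zero]
  | succ k ih =>
    have h1 := psum_succ (fun i : Fin n => d (i + 1) + i - d i) ⟨k, hk⟩
    have h2 := hd.le_succ_add k
    simp only at h1
    rw [h1, ih (by omega), choose_two_succ]
    omega

theorem IsExcess.isLandau (hd : IsExcess n d) :
    IsLandau (fun i : Fin n => d (i + 1) + i - d i) where
  monotone := by
    have : Monotone fun i : ℕ => d (i + 1) + i - d i := monotone_nat_of_le_succ fun i => by
      have h1 := hd.convex i
      have h2 := hd.le_succ_add i
      have h3 := hd.le_succ_add (i + 1)
      simp only [add_assoc, Nat.reduceAdd] at *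
      omega
    exact fun i j hij => this hij
  choose_two_le k hk := by rw [hd.psum_eq hk]; omega
  psum_eq := by rw [hd.psum_eq le_rfl, hd.eq_zero n le_rfl, zero_add]

theorem IsExcess.excess_eq (hd : IsExcess n d) :
    excess (fun i : Fin n => d (i + 1) + i - d i) = d := by
  funext k
  by_cases hk : k ≤ n
  · rw [excess, hd.psum_eq hk]; omega
  · rw [hd.isLandau.isExcess.eq_zero k (by omega), hd.eq_zero k (by omega)]

theorem bijOn_excess (n : ℕ) : Set.BijOn excess (scoreSequences n) {d | IsExcess n d} := by
  refine ⟨fun f hf => (mem_scoreSequences_iff.1 hf).isExcess, ?_, ?_⟩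
  · intro f hf g hg hfg
    rw [mem_scoreSequences_iff] at hf hg
    have h : ∀ k ≤ n, psum f k = psum g k := fun k hk => by
      have h1 := hf.choose_two_le k hk
      have h2 := hg.choose_two_le k hk
      have h3 := congrFun hfg k
      simp only [excess] at h3
      omega
    funext i
    have h1 := psum_succ f i
    have h2 := psum_succ g i
    have h3 := h (i + 1) i.2
    have h4 := h i i.2.le
    omega
  · intro d hd
    exact ⟨_, mem_scoreSequences_iff.2 hd.isLandau, hd.excess_eq⟩

theorem IsLandau.numIrreducible_eq (hf : IsLandau f) : numIrreducible f = zeros n (excess f) := by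
  rw [numIrreducible, zeros, Finset.card_filter, Finset.range_eq_Ico,
    Finset.sum_Ico_add' (fun i => if excess f i = 0 then 1 else 0) 0 n 1]
  refine Finset.sum_congr (by ext; simp) fun k hk => ?_
  simp only [Finset.mem_Ico] at hk
  have h1 := hf.choose_two_le k (by omega)
  refine if_congr ?_ rfl rfl
  change psum f k = _ ↔ _
  rw [excess]
  omega

theorem finite_isExcess (n : ℕ) : {d | IsExcess n d}.Finite := by
  rw [← (bijOn_excess n).image_eq]
  exact (finite_scoreSequences n).image _

/-- The excess sequences of the score sequences on `K_n`. -/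
noncomputable def excessSet (n : ℕ) : Finset (ℕ → ℕ) := (finite_isExcess n).toFinset

@[simp] theorem mem_excessSet : d ∈ excessSet n ↔ IsExcess n d := by simp [excessSet]

theorem S_eq_card (n : ℕ) : S n = (excessSet n).card := by
  rw [S, ← (bijOn_excess n).injOn.ncard_image, (bijOn_excess n).image_eq,
    ← Set.ncard_coe_finset]
  simp [excessSet]

theorem Sirr_eq_card (n m : ℕ) : Sirr n m = ((excessSet n).filter (zeros n · = m)).card := by
  have hsub : {s ∈ scoreSequences n | numIrreducible s = m} ⊆ scoreSequences n := fun s hs => hs.1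
  rw [Sirr, ← ((bijOn_excess n).injOn.mono hsub).ncard_image, ← Set.ncard_coe_finset]
  congr 1
  ext d
  simp only [Set.mem_image, Set.mem_ofPred_eq, Finset.coe_filter, mem_excessSet]
  constructor
  · rintro ⟨f, ⟨hf, hm⟩, rfl⟩
    rw [mem_scoreSequences_iff] at hf
    exact ⟨hf.isExcess, by rw [← hf.numIrreducible_eq, hm]⟩
  · rintro ⟨hd, hm⟩
    refine ⟨_, ⟨mem_scoreSequences_iff.2 hd.isLandau, ?_⟩, hd.excess_eq⟩
    rw [hd.isLandau.numIrreducible_eq, hd.excess_eq, hm]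

end Excess

/-! ### Decomposition at the first return to zero. -/

section FirstReturn

open Finset

/-- The first positive zero of `d`. -/
noncomputable def ret (d : ℕ → ℕ) : ℕ := sInf {k | 1 ≤ k ∧ d k = 0}

/-- The concatenation of `e`, of length `k`, and `g`. -/
def cat (k : ℕ) (e g : ℕ → ℕ) (i : ℕ) : ℕ := if i ≤ k then e i else g (i - k)

/-- The excess sequences of the irreducible score sequences on `K_n`. -/
noncomputable def irrSet (n : ℕ) : Finset (ℕ → ℕ) := (excessSet n).filter (ret · = n)

variable {n k m : ℕ} {d e g : ℕ → ℕ}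

theorem ret_le (hk : 1 ≤ k) (h : d k = 0) : ret d ≤ k := Nat.sInf_le ⟨hk, h⟩

theorem ne_zero_of_lt_ret (hk : 1 ≤ k) (h : k < ret d) : d k ≠ 0 := fun h' => by
  have := ret_le hk h'
  omega

theorem IsExcess.ret_mem (hd : IsExcess n d) : 1 ≤ ret d ∧ d (ret d) = 0 :=
  -- The witness `n + 1` instead of `n` covers `n = 0`.
  Nat.sInf_mem (s := {k | 1 ≤ k ∧ d k = 0}) ⟨n + 1, by omega, hd.eq_zero _ (by omega)⟩

theorem IsExcess.ret_le (hd : IsExcess n d) (hn : 1 ≤ n) : ret d ≤ n :=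
  ScoreSeq.ret_le hn (hd.eq_zero n le_rfl)

theorem ret_eq_of_forall (hk : 1 ≤ k) (h0 : d k = 0) (h : ∀ i, 1 ≤ i → i < k → d i ≠ 0) :
    ret d = k := by
  refine le_antisymm (ret_le hk h0) (le_csInf ⟨k, hk, h0⟩ fun i hi => ?_)
  by_contra hlt
  exact h i hi.1 (not_le.1 hlt) hi.2

theorem mem_irrSet : e ∈ irrSet k ↔ IsExcess k e ∧ ret e = k := by simp [irrSet]

theorem one_le_of_mem_irrSet (he : e ∈ irrSet k) : 1 ≤ k := by
  obtain ⟨h, h'⟩ := mem_irrSet.1 he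
  have := h.ret_mem
  omega

theorem IsExcess.cat (he : IsExcess k e) (hg : IsExcess m g) :
    IsExcess (k + m) (cat k e g) where
  zero := by simp [ScoreSeq.cat, he.zero]
  eq_zero i hi := by
    rw [ScoreSeq.cat]
    split_ifs with h
    · exact he.eq_zero i (by omega)
    · exact hg.eq_zero _ (by omega)
  convex i := by
    have ek := he.eq_zero k le_rfl
    simp only [ScoreSeq.cat]
    rcases lt_trichotomy (i + 1) k with h | h | h
    · have := he.convex i
      rw [if_pos (by omega), if_pos (by omega), if_pos (by omega)]
      exact this
    -- At the junction the middle value is 0, so the inequality is trivial.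
    · rw [if_pos (by omega), h, ek]; omega
    · have h1 := hg.convex (i - k)
      have e1 : i + 1 - k = i - k + 1 := by omega
      have e2 : i + 2 - k = i - k + 2 := by omega
      rw [if_neg (by omega), if_neg (by omega), e1, e2]
      split_ifs with h2
      · have : i = k := by omega
        subst this
        rw [Nat.sub_self, hg.zero] at h1
        rw [ek, Nat.sub_self]; exact h1
      · exact h1

theorem ret_cat (he : e ∈ irrSet k) : ret (cat k e g) = k := by
  obtain ⟨h, h'⟩ := mem_irrSet.1 he
  refine ret_eq_of_forall (one_le_of_mem_irrSet he) ?_ fun i hi hik => ?_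
  · simp [cat, h.eq_zero k le_rfl]
  · rw [cat, if_pos hik.le]
    exact ne_zero_of_lt_ret hi (h'.symm ▸ hik)

theorem zeros_cat (he : e ∈ irrSet k) (m : ℕ) :
    zeros (k + m) (cat k e g) = zeros m g + 1 := by
  obtain ⟨h, h'⟩ := mem_irrSet.1 he
  have hk := one_le_of_mem_irrSet he
  rw [zeros, zeros, sum_range_add, add_comm]
  congr 1
  · refine sum_congr rfl fun i _ => ?_
    rw [cat, if_neg (show ¬ k + i + 1 ≤ k by omega), show k + i + 1 - k = i + 1 by omega]
  · rw [sum_eq_single (k - 1)]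
    · rw [cat, if_pos (show k - 1 + 1 ≤ k by omega), if_pos (h.eq_zero _ (by omega))]
    · intro i hi hik
      rw [mem_range] at hi
      rw [cat, if_pos (show i + 1 ≤ k by omega), if_neg (ne_zero_of_lt_ret (by omega) (by omega))]
    · intro hk'
      exact absurd (mem_range.2 (by omega)) hk'

theorem IsExcess.head (hd : IsExcess n d) :
    (fun i => if i ≤ ret d then d i else 0) ∈ irrSet (ret d) := by
  obtain ⟨h1, h2⟩ := hd.ret_mem
  rw [mem_irrSet]
  refine ⟨⟨by simp [hd.zero], fun i hi => ?_, fun i => ?_⟩, ?_⟩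
  · rcases hi.eq_or_lt with h | h
    · simp [← h, h2]
    · simp [not_le.2 h]
  · have := hd.convex i
    rcases lt_trichotomy (i + 1) (ret d) with h | h | h
    · simpa [show i ≤ ret d by omega, show i + 1 ≤ ret d by omega,
        show i + 2 ≤ ret d by omega] using this
    · simp [h, h2]
    · simp [show ¬ (i + 1 ≤ ret d) by omega]
  · refine ret_eq_of_forall h1 (by simp [h2]) fun i hi hik => ?_
    simp only [hik.le, if_true]
    exact ne_zero_of_lt_ret hi hik

theorem IsExcess.tail (hd : IsExcess n d) : IsExcess (n - ret d) (fun i => d (i + ret d)) where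
  zero := by simp [hd.ret_mem.2]
  eq_zero i hi := hd.eq_zero _ (by omega)
  convex i := by
    have := hd.convex (i + ret d)
    rwa [show i + ret d + 1 = i + 1 + ret d by ring, show i + ret d + 2 = i + 2 + ret d by ring]
      at this

/-- Decomposition of excess sequences at their first return to zero. -/
theorem sum_excessSet_eq (hn : 1 ≤ n) (w : (ℕ → ℕ) → ℕ) :
    ∑ d ∈ excessSet n, w d = ∑ p ∈ antidiagonal n, ∑ q ∈ irrSet p.1 ×ˢ excessSet p.2,
      w (cat p.1 q.1 q.2) := by
  rw [Finset.sum_sigma']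
  refine Finset.sum_bij'
    (fun d _ => ⟨(ret d, n - ret d), (fun i => if i ≤ ret d then d i else 0),
      fun i => d (i + ret d)⟩)
    (fun x _ => cat x.1.1 x.2.1 x.2.2) ?_ ?_ ?_ ?_ ?_
  · intro d hd
    rw [mem_excessSet] at hd
    have h1 := hd.ret_le hn
    simp only [mem_sigma, HasAntidiagonal.mem_antidiagonal, mem_product, mem_excessSet]
    exact ⟨by omega, hd.head, hd.tail⟩
  · rintro ⟨⟨k, m⟩, e, g⟩ hx
    simp only [mem_sigma, HasAntidiagonal.mem_antidiagonal, mem_product, mem_excessSet] at hx ⊢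
    rw [← hx.1]
    exact (mem_irrSet.1 hx.2.1).1.cat hx.2.2
  · intro d hd
    funext i
    simp only [cat]
    split_ifs with h
    · rfl
    · rw [Nat.sub_add_cancel (by omega)]
  · rintro ⟨⟨k, m⟩, e, g⟩ hx
    simp only [mem_sigma, HasAntidiagonal.mem_antidiagonal, mem_product, mem_excessSet] at hx
    obtain ⟨h1, h2, h3⟩ := hx
    simp only [ret_cat h2]
    have h4 : n - k = m := by omega
    rw [h4]
    congr 2
    · funext i
      simp only [cat]
      split_ifs with h
      · rfl
      · exact ((mem_irrSet.1 h2).1.eq_zero i (by omega)).symm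
    · funext i
      simp only [cat]
      split_ifs with h
      · have : i = 0 := by omega
        subst this
        rw [zero_add, (mem_irrSet.1 h2).1.eq_zero k le_rfl, h3.zero]
      · rw [Nat.add_sub_cancel]
  · intro d hd
    congr 1
    funext i
    simp only [cat]
    split_ifs with h
    · rfl
    · rw [Nat.sub_add_cancel (by omega)]

/-- The number of irreducible score sequences on `K_n`. -/
noncomputable def irrCount (n : ℕ) : ℕ := (irrSet n).card

/-- The zero sequence of length 0 has first positive zero 1, not 0. So `I` has no constant term and
`1 - I` is invertible. -/
theorem irrCount_zero : irrCount 0 = 0 := by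
  rw [irrCount, card_eq_zero, eq_empty_iff_forall_notMem]
  intro e he
  have := one_le_of_mem_irrSet he
  omega

theorem S_eq_sum (hn : 1 ≤ n) : S n = ∑ p ∈ antidiagonal n, irrCount p.1 * S p.2 := by
  rw [S_eq_card, card_eq_sum_ones, sum_excessSet_eq hn]
  refine sum_congr rfl fun p _ => ?_
  rw [← card_eq_sum_ones, card_product, S_eq_card, irrCount]

theorem Sirr_succ_eq_sum (hn : 1 ≤ n) (m : ℕ) :
    Sirr n (m + 1) = ∑ p ∈ antidiagonal n, irrCount p.1 * Sirr p.2 m := by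
  rw [Sirr_eq_card, card_filter, sum_excessSet_eq hn]
  refine sum_congr rfl fun p hp => ?_
  rw [irrCount, Sirr_eq_card, ← card_product, card_eq_sum_ones, ← Finset.filter_product_right,
    sum_filter]
  refine sum_congr rfl fun q hq => ?_
  rw [← HasAntidiagonal.mem_antidiagonal.1 hp, zeros_cat (mem_product.1 hq).1]
  simp

theorem sum_ret_eq (hn : 1 ≤ n) :
    ∑ d ∈ excessSet n, ret d = ∑ p ∈ antidiagonal n, p.1 * irrCount p.1 * S p.2 := by
  rw [sum_excessSet_eq hn]
  refine sum_congr rfl fun p _ => ?_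
  rw [sum_congr rfl fun q hq => ret_cat (mem_product.1 hq).1, sum_const, card_product,
    ← irrCount, ← S_eq_card, smul_eq_mul]
  ring

theorem excessSet_zero : excessSet 0 = {0} := by
  ext d
  rw [mem_excessSet, mem_singleton]
  constructor
  · intro h
    funext i
    exact h.eq_zero i (Nat.zero_le i)
  · rintro rfl
    exact ⟨rfl, fun _ _ => rfl, fun _ => by simp⟩

theorem S_zero : S 0 = 1 := by rw [S_eq_card, excessSet_zero, card_singleton]

theorem Sirr_zero_left (m : ℕ) : Sirr 0 m = if m = 0 then 1 else 0 := by
  rw [Sirr_eq_card, excessSet_zero, filter_singleton]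
  by_cases hm : m = 0
  · simp [hm, zeros]
  · simp [hm, zeros, Ne.symm hm]

theorem Sirr_zero_right (hn : 1 ≤ n) : Sirr n 0 = 0 := by
  rw [Sirr_eq_card, card_eq_zero, eq_empty_iff_forall_notMem]
  intro d hd
  rw [mem_filter, mem_excessSet, zeros, sum_eq_zero_iff] at hd
  have := hd.2 (n - 1) (mem_range.2 (by omega))
  rw [show n - 1 + 1 = n by omega, hd.1.eq_zero n le_rfl] at this
  simp at this

end FirstReturn

/-! ### A cycle lemma for excess sequences. -/

section Cyclic

open Finset

/-- Periodic versions of excess sequences, without the positivity condition. -/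
structure IsCyclic (n : ℕ) (c : ℕ → ℤ) : Prop where
  zero : c 0 = 0
  periodic : ∀ i, c (i + n) = c i
  convex : ∀ i, 2 * c (i + 1) ≤ c (i + 2) + c i + 1

/-- The excess sequence `d` of length `n`, made periodic and started at time `r`. -/
def rot (n : ℕ) (d : ℕ → ℕ) (r : ℕ) (i : ℕ) : ℤ := d ((i + r) % n) - d r

variable {n : ℕ} {d : ℕ → ℕ} {c : ℕ → ℤ}

theorem IsExcess.apply_succ_mod (hd : IsExcess n d) (hn : 1 ≤ n) (i : ℕ) :
    d ((i + 1) % n) = d (i % n + 1) := by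
  have h := Nat.mod_lt i hn
  rw [Nat.add_mod, Nat.add_mod_eq_ite, Nat.mod_mod]
  rcases Nat.eq_or_lt_of_le hn with h1 | h1
  · subst h1
    simp [hd.zero, hd.eq_zero 1 le_rfl, Nat.mod_one]
  · rw [Nat.mod_eq_of_lt h1, Nat.mod_eq_of_lt h1]
    split_ifs with h2
    · rw [hd.eq_zero _ h2, show i % n + 1 - n = 0 by omega, hd.zero]
    · rfl

theorem IsExcess.isCyclic_rot (hd : IsExcess n d) (hn : 1 ≤ n) {r : ℕ} (hr : r < n) :
    IsCyclic n (rot n d r) where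
  zero := by simp [rot, Nat.mod_eq_of_lt hr]
  periodic i := by
    rw [rot, rot, add_right_comm, Nat.add_mod_right]
  convex i := by
    have h := Nat.mod_lt (i + r) hn
    have e1 := hd.apply_succ_mod hn (i + r)
    have e2 := hd.apply_succ_mod hn (i + r + 1)
    have h1 := hd.convex ((i + r) % n)
    simp only [rot]
    rw [show i + 1 + r = i + r + 1 by ring, show i + 2 + r = i + r + 1 + 1 by ring]
    by_cases h2 : (i + r) % n + 1 = n
    · rw [h2, hd.eq_zero n le_rfl] at e1
      omega
    · have h3 : (i + r + 1) % n = (i + r) % n + 1 := by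
        rw [Nat.add_mod_eq_ite]
        have h4 : 1 % n = 1 := Nat.mod_eq_of_lt (by omega)
        rw [h4, if_neg (by omega)]
      rw [h3] at e2
      rw [e1, e2]
      have : (i + r) % n + 1 + 1 = (i + r) % n + 2 := rfl
      rw [this]
      omega

theorem IsCyclic.apply_mod (hc : IsCyclic n c) (i : ℕ) : c (i % n) = c i := by
  have h : ∀ q j, c (j + n * q) = c j := fun q => by
    induction q with
    | zero => simp
    | succ q ih => intro j; rw [mul_add, mul_one, ← add_assoc, hc.periodic, ih]
  conv_rhs => rw [← Nat.mod_add_div i n]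
  rw [h]

/-- At time `n - r` the rotated sequence is at the start of `d`; as `d ≥ 0`, this is its minimum. -/
theorem rot_min (hd : IsExcess n d) {r : ℕ} (hr : r < n) :
    rot n d r (n - r) = -d r := by
  rw [rot, Nat.sub_add_cancel hr.le, Nat.mod_self, hd.zero]
  simp

/-- Both rotations have the same minimum. If `r < r'`, reading the minimum at time `n - r` in terms
of `d'` gives `d' (r' - r) = 0`, a return before `ret d'`. -/
theorem le_of_rot_eq {d' : ℕ → ℕ} (hd : IsExcess n d) (hd' : IsExcess n d') {r r' : ℕ}
    (hrn : r < n) (hr' : r' < ret d') (hrn' : r' < n) (h : rot n d r = rot n d' r') : r' ≤ r := by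
  by_contra hlt
  have h1 := congrFun h (n - r)
  have h2 := congrFun h (n - r')
  rw [rot_min hd hrn] at h1
  rw [rot_min hd' hrn'] at h2
  have h3 : (n - r + r') % n = r' - r := by
    rw [show n - r + r' = r' - r + n by omega, Nat.add_mod_right, Nat.mod_eq_of_lt (by omega)]
  rw [rot, h3] at h1
  rw [rot] at h2
  exact ne_zero_of_lt_ret (d := d') (k := r' - r) (by omega) (by omega) (by omega)

theorem bijOn_rot (hn : 1 ≤ n) :
    Set.BijOn (fun x : Σ _ : ℕ → ℕ, ℕ => rot n x.1 x.2)
      ((excessSet n).sigma fun d => range (ret d)) {c | IsCyclic n c} := by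
  refine ⟨?_, ?_, ?_⟩
  · rintro ⟨d, r⟩ hx
    simp only [coe_sigma, Set.mem_sigma_iff, mem_coe, mem_excessSet, mem_range] at hx
    exact hx.1.isCyclic_rot hn (hx.2.trans_le (hx.1.ret_le hn))
  · rintro ⟨d, r⟩ hx ⟨d', r'⟩ hx' h
    simp only [coe_sigma, Set.mem_sigma_iff, mem_coe, mem_excessSet, mem_range] at hx hx' h
    obtain ⟨hd, hr⟩ := hx
    obtain ⟨hd', hr'⟩ := hx'
    have hrn := hr.trans_le (hd.ret_le hn)
    have hrn' := hr'.trans_le (hd'.ret_le hn)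
    obtain rfl : r = r' := le_antisymm (le_of_rot_eq hd' hd hrn' hr hrn h.symm)
      (le_of_rot_eq hd hd' hrn hr' hrn' h)
    have h0 := congrFun h (n - r)
    rw [rot_min hd hrn, rot_min hd' hrn] at h0
    obtain rfl : d = d' := by
      funext i
      by_cases hi : i < n
      · have h1 := congrFun h (i + (n - r))
        have h2 : (i + (n - r) + r) % n = i := by
          rw [add_assoc, Nat.sub_add_cancel hrn.le, Nat.add_mod_right, Nat.mod_eq_of_lt hi]
        simp only [rot, h2] at h1
        omega
      · rw [hd.eq_zero i (not_lt.1 hi), hd'.eq_zero i (not_lt.1 hi)]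
    rfl
  · intro c hc
    obtain ⟨i₀, hi₀, hmin⟩ := exists_min_image (Icc 1 n) c ⟨1, by simp [hn]⟩
    rw [mem_Icc] at hi₀
    have hmin' : ∀ i, c i₀ ≤ c i := fun i => by
      rw [← hc.apply_mod i]
      have := Nat.mod_lt i hn
      rcases Nat.eq_zero_or_pos (i % n) with h | h
      · rw [h, ← hc.periodic 0, zero_add]
        exact hmin n (mem_Icc.2 ⟨hn, le_rfl⟩)
      · exact hmin _ (mem_Icc.2 ⟨h, this.le⟩)
    -- The least such `r` makes `n - r` the last time in `1, ..., n` at which `c` is minimal.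
    -- Starting `d` there forces `r < ret d`, since an earlier return would be a later minimum.
    have hex : ∃ r, r < n ∧ c (n - r) = c i₀ :=
      ⟨n - i₀, by omega, by rw [show n - (n - i₀) = i₀ by omega]⟩
    classical
    obtain ⟨hrn, hr⟩ := Nat.find_spec hex
    have hrmin : ∀ {k}, k < Nat.find hex → ¬ (k < n ∧ c (n - k) = c i₀) := fun h =>
      Nat.find_min hex h
    set r := Nat.find hex
    set μ := c i₀
    set d : ℕ → ℕ := fun i => if i ≤ n then (c (i + (n - r)) - μ).toNat else 0 with hdef
    have hdc : ∀ i ≤ n, (d i : ℤ) = c (i + (n - r)) - μ := fun i hi => by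
      have := hmin' (i + (n - r))
      simp only [hdef, if_pos hi]
      omega
    have hdz : ∀ i, n < i → d i = 0 := fun i hi => by simp only [hdef, if_neg (not_le.2 hi)]
    have hdn : d n = 0 := by
      have := hdc n le_rfl
      rw [add_comm, hc.periodic, hr] at this
      omega
    have hd : IsExcess n d := by
      refine ⟨?_, fun i hi => ?_, fun i => ?_⟩
      · have := hdc 0 (Nat.zero_le n)
        rw [zero_add, hr] at this
        omega
      · rcases hi.eq_or_lt with h | h
        · rw [← h, hdn]
        · exact hdz i h
      · by_cases h : i + 2 ≤ n
        · have h0 := hdc i (by omega)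
          have h1 := hdc (i + 1) (by omega)
          have h2 := hdc (i + 2) h
          have h3 := hc.convex (i + (n - r))
          rw [show i + 1 + (n - r) = i + (n - r) + 1 by ring] at h1
          rw [show i + 2 + (n - r) = i + (n - r) + 2 by ring] at h2
          omega
        · have : d (i + 1) = 0 := by
            rcases (show n ≤ i + 1 by omega).eq_or_lt with h | h
            · rw [← h, hdn]
            · exact hdz _ h
          omega
    have hret : r < ret d := by
      by_contra hle
      obtain ⟨h1, h2⟩ := hd.ret_mem
      refine hrmin (k := r - ret d) (by omega) ⟨by omega, ?_⟩
      have h3 := hdc (ret d) (by omega)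
      rw [show n - (r - ret d) = ret d + (n - r) by omega]
      omega
    refine ⟨⟨d, r⟩, ?_, ?_⟩
    · simp only [coe_sigma, Set.mem_sigma_iff, mem_coe, mem_excessSet, mem_range]
      exact ⟨hd, hret⟩
    · funext i
      have h1 := hdc ((i + r) % n) (Nat.mod_lt _ hn).le
      have h2 := hdc r hrn.le
      have h3 : c (r + (n - r)) = 0 := by
        rw [show r + (n - r) = 0 + n by omega, hc.periodic, hc.zero]
      have h4 : c ((i + r) % n + (n - r)) = c i := by
        rw [← hc.apply_mod, Nat.mod_add_mod, add_assoc, show r + (n - r) = n by omega,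
          Nat.add_mod_right, hc.apply_mod]
      simp only [rot]
      omega

theorem ncard_isCyclic (hn : 1 ≤ n) :
    {c | IsCyclic n c}.ncard = ∑ d ∈ excessSet n, ret d := by
  rw [← (bijOn_rot hn).image_eq, (bijOn_rot hn).injOn.ncard_image, Set.ncard_coe_finset,
    card_sigma]
  simp

end Cyclic

/-! ### Cyclic sequences, staircases and subsets with sum divisible by `n`. -/

section Staircase

open Finset

/-- Monotone maps `s : ℤ → ℤ` with `s (j + n) = s j + n`. -/
structure IsStair (n : ℕ) (s : ℤ → ℤ) : Prop where
  monotone : Monotone s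
  add_period : ∀ j, s (j + n) = s j + n

/-- The extension to `ℤ` of a sequence `b 0, …, b (n - 1)` with `s (j + n) = s j + n`. -/
def stairExt (n : ℕ) (b : ℕ → ℤ) (j : ℤ) : ℤ := b (j % n).toNat + n * (j / n)

variable {n : ℕ} {s t : ℤ → ℤ} {b : ℕ → ℤ}

theorem stairExt_apply {r : ℕ} (hr : r < n) (q : ℤ) :
    stairExt n b (r + n * q) = b r + n * q := by
  have h1 : ((r : ℤ) + n * q) % n = r := by
    rw [Int.add_mul_emod_self_left, Int.emod_eq_of_lt (by omega) (by omega)]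
  have h2 : ((r : ℤ) + n * q) / n = q := by
    rw [Int.add_mul_ediv_left _ _ (by omega), Int.ediv_eq_zero_of_lt (by omega) (by omega), zero_add]
  rw [stairExt, h1, h2, Int.toNat_natCast]

theorem stairExt_natCast {r : ℕ} (hr : r < n) : stairExt n b r = b r := by
  simpa using stairExt_apply (b := b) hr 0

theorem exists_eq_add_mul (hn : 1 ≤ n) (j : ℤ) : ∃ r < n, ∃ q : ℤ, j = (r : ℕ) + n * q := by
  have h1 := Int.emod_nonneg j (by omega : (n : ℤ) ≠ 0)
  have h2 := Int.emod_lt_of_pos j (by omega : (0 : ℤ) < n)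
  refine ⟨(j % n).toNat, by omega, j / n, ?_⟩
  rw [Int.toNat_of_nonneg h1, Int.emod_add_mul_ediv]

theorem isStair_stairExt (hn : 1 ≤ n) (hb : ∀ i, i + 1 < n → b i ≤ b (i + 1))
    (hb' : b (n - 1) ≤ b 0 + n) : IsStair n (stairExt n b) where
  monotone := monotone_int_of_le_succ fun j => by
    obtain ⟨r, hr, q, rfl⟩ := exists_eq_add_mul hn j
    rw [stairExt_apply hr]
    by_cases h : r + 1 < n
    · have e : (r : ℤ) + n * q + 1 = (r + 1 : ℕ) + n * q := by push_cast; ring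
      rw [e, stairExt_apply h]
      have := hb r h
      omega
    · obtain rfl : r = n - 1 := by omega
      have e : ((n - 1 : ℕ) : ℤ) + n * q + 1 = (0 : ℕ) + n * (q + 1) := by
        push_cast [hn]; ring
      rw [e, stairExt_apply (by omega), mul_add, mul_one]
      omega
  add_period j := by
    obtain ⟨r, hr, q, rfl⟩ := exists_eq_add_mul hn j
    have e : (r : ℤ) + n * q + n = r + n * (q + 1) := by ring
    rw [e, stairExt_apply hr, stairExt_apply hr]
    ring

theorem IsStair.add_mul (hs : IsStair n s) (j q : ℤ) : s (j + n * q) = s j + n * q := by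
  induction q with
  | zero => simp
  | succ q ih => rw [mul_add, mul_one, ← add_assoc, hs.add_period, ih, add_assoc]
  | pred q ih =>
    have h := hs.add_period (j + n * (-(q : ℤ) - 1))
    rw [show j + n * (-(q : ℤ) - 1) + n = j + n * -q by ring, ih] at h
    linear_combination -h

theorem IsStair.ext (hn : 1 ≤ n) (hs : IsStair n s) (ht : IsStair n t)
    (h : ∀ i : ℕ, i < n → s i = t i) : s = t := by
  funext j
  obtain ⟨r, hr, q, rfl⟩ := exists_eq_add_mul hn j
  rw [hs.add_mul, ht.add_mul, h r hr]

theorem IsStair.shift (hs : IsStair n s) (r : ℤ) : IsStair n fun j => s (j + r) where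
  monotone _ _ h := hs.monotone (by omega)
  add_period j := by rw [add_right_comm, hs.add_period]

/-- The sum of `s` over the window `0, …, n - 1`. -/
def window (n : ℕ) (s : ℤ → ℤ) : ℤ := ∑ i ∈ range n, s i

/-- Shifting by one replaces a value `s r` by `s (r + n) = s r + n`. Thus the window sum is
invariant modulo `n` and determines the amount of shift. -/
theorem IsStair.window_shift (hs : IsStair n s) (r : ℤ) :
    window n (fun j => s (j + r)) = window n s + n * r := by
  have step : ∀ r : ℤ, window n (fun j => s (j + (r + 1))) = window n (fun j => s (j + r)) + n := by
    intro r
    have h1 := sum_range_succ (fun i : ℕ => s (i + r)) n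
    have h2 := sum_range_succ' (fun i : ℕ => s (i + r)) n
    rw [h1, add_comm (n : ℤ) r, hs.add_period] at h2
    simp only [window]
    have h3 : ∑ i ∈ range n, s ((i + 1 : ℕ) + r) = ∑ i ∈ range n, s (i + (r + 1)) :=
      sum_congr rfl fun i _ => by congr 1; push_cast; ring
    rw [h3] at h2
    simp only [Nat.cast_zero, zero_add] at h2
    linear_combination -h2
  induction r with
  | zero => simp
  | succ q ih => rw [step, ih]; ring
  | pred q ih =>
    have h := step (-(q : ℤ) - 1)
    rw [show -(q : ℤ) - 1 + 1 = -q by ring, ih] at h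
    linear_combination -h

theorem sum_range_cast (n : ℕ) : ∑ i ∈ range n, (i : ℤ) = (n.choose 2 : ℕ) := by
  rw [← Nat.cast_sum, sum_range_id, Nat.choose_two_right]

/-- Staircases with a given sum over the window. -/
def balancedStairs (n : ℕ) : Set (ℤ → ℤ) := {s | IsStair n s ∧ window n s = (n.choose 2 : ℕ)}

/-- Staircases that cross zero at the origin. -/
def crossingStairs (n : ℕ) : Set (ℤ → ℤ) :=
  {s | IsStair n s ∧ (n : ℤ) ∣ window n s - (n.choose 2 : ℕ) ∧ s (-1) < 0 ∧ 0 ≤ s 0}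

theorem isCyclic_of_mem_balancedStairs (h : s ∈ balancedStairs n) :
    IsCyclic n fun j => ∑ i ∈ range j, (s i - i) := by
  obtain ⟨hs, hw⟩ := h
  refine ⟨by simp, fun j => ?_, fun j => ?_⟩
  · induction j with
    | zero =>
      simp only [zero_add, sum_sub_distrib, sum_range_cast, ← hw, window]
      simp
    | succ j ih =>
      simp only [show j + 1 + n = j + n + 1 by ring, sum_range_succ] at ih ⊢
      rw [ih]
      push_cast
      rw [hs.add_period]
      ring
  · have h : s j ≤ s (j + 1 : ℕ) := hs.monotone (by simp)
    simp only [sum_range_succ]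
    push_cast at h ⊢
    linarith

/-- The inverse is `s j = c (j + 1) - c j + j`: convexity of `c` is monotonicity of `s`, and
periodicity of `c` gives both `s (j + n) = s j + n` and the window sum. -/
theorem bijOn_balancedStairs (hn : 1 ≤ n) :
    Set.BijOn (fun (s : ℤ → ℤ) (j : ℕ) => ∑ i ∈ range j, (s i - i)) (balancedStairs n)
      {c | IsCyclic n c} := by
  refine ⟨fun s hs => isCyclic_of_mem_balancedStairs hs, ?_, ?_⟩
  · rintro s ⟨hs, -⟩ t ⟨ht, -⟩ h
    refine hs.ext hn ht fun i _ => ?_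
    have h1 := congrFun h (i + 1)
    have h2 := congrFun h i
    simp only [sum_range_succ] at h1 h2
    linarith
  · intro c hc
    set b : ℕ → ℤ := fun j => c (j + 1) - c j + j with hb
    have hst : IsStair n (stairExt n b) := by
      have hmono : ∀ i, b i ≤ b (i + 1) := fun i => by
        have := hc.convex i
        simp only [hb, add_assoc, Nat.reduceAdd]
        push_cast
        linarith
      refine isStair_stairExt hn (fun i _ => hmono i) ?_
      have h1 := hmono (n - 1)
      have h2 : b (n - 1 + 1) = b 0 + n := by
        rw [Nat.sub_add_cancel hn]
        have h3 := hc.periodic 1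
        have h4 := hc.periodic 0
        rw [zero_add] at h4
        rw [add_comm] at h3
        simp only [hb, h3, h4]
        simp
      omega
    have hsum : ∀ j ≤ n, ∑ i ∈ range j, (stairExt n b i - i) = c j := fun j hj => by
      rw [sum_congr rfl fun i hi => by
        rw [stairExt_natCast (b := b) ((mem_range.1 hi).trans_le hj)]]
      simp only [hb, add_sub_cancel_right]
      rw [sum_range_sub, hc.zero, sub_zero]
    have hw : window n (stairExt n b) = (n.choose 2 : ℕ) := by
      have h := hsum n le_rfl
      have h0 := hc.periodic 0
      rw [zero_add, hc.zero] at h0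
      rw [sum_sub_distrib, sum_range_cast, h0] at h
      rw [window]; linarith
    refine ⟨stairExt n b, ⟨hst, hw⟩, ?_⟩
    have hc' := isCyclic_of_mem_balancedStairs (s := stairExt n b) ⟨hst, hw⟩
    funext j
    rw [← hc.apply_mod j, ← hsum _ (Nat.mod_lt j hn).le]
    exact (hc'.apply_mod j).symm

theorem IsStair.exists_crossing (hn : 1 ≤ n) (hs : IsStair n s) :
    ∃ q : ℤ, s (q - 1) < 0 ∧ 0 ≤ s q := by
  have h0 : ∀ q : ℤ, s (n * q) = s 0 + n * q := fun q => by simpa using hs.add_mul 0 q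
  have hn' : (1 : ℤ) ≤ n := by exact_mod_cast hn
  obtain ⟨q, h1, h2⟩ := Int.exists_least_of_bdd (P := fun q => 0 ≤ s q)
    ⟨n * (-|s 0| - 1), fun z hz => by
      by_contra hlt
      have h3 := hs.monotone (not_le.1 hlt).le
      rw [h0] at h3
      have := le_abs_self (s 0)
      nlinarith [abs_nonneg (s 0)]⟩
    ⟨n * |s 0|, by
      rw [h0]
      have := neg_abs_le (s 0)
      nlinarith [abs_nonneg (s 0)]⟩
  refine ⟨q, ?_, h1⟩
  by_contra h
  have := h2 _ (not_lt.1 h)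
  omega

/-- Each shift class whose window sum has the right residue modulo `n` contains exactly one balanced
staircase, by `window_shift`, and exactly one crossing zero at the origin, by monotonicity. -/
theorem ncard_balancedStairs_eq (hn : 1 ≤ n) :
    (balancedStairs n).ncard = (crossingStairs n).ncard := by
  have hn' : (n : ℤ) ≠ 0 := by omega
  have hcross : ∀ s, ∃ q : ℤ, IsStair n s → s (q - 1) < 0 ∧ 0 ≤ s q := fun s => by
    by_cases hs : IsStair n s
    · obtain ⟨q, hq⟩ := hs.exists_crossing hn
      exact ⟨q, fun _ => hq⟩
    · exact ⟨0, fun h => absurd h hs⟩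
  choose q hq using hcross
  have hbij : Set.BijOn (fun s j => s (j + q s)) (balancedStairs n) (crossingStairs n) := by
    refine ⟨?_, ?_, ?_⟩
    · rintro s ⟨hs, hw⟩
      refine ⟨hs.shift _, ?_, ?_, ?_⟩
      · rw [hs.window_shift, hw, add_sub_cancel_left]
        exact dvd_mul_right _ _
      · have := (hq s hs).1
        rwa [sub_eq_neg_add] at this
      · have := (hq s hs).2
        simpa using this
    · rintro s ⟨hs, hw⟩ t ⟨ht, hw'⟩ h
      have h1 := congrArg (window n) h
      simp only [hs.window_shift, ht.window_shift] at h1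
      rw [hw, hw', add_right_inj] at h1
      have h2 := mul_left_cancel₀ hn' h1
      funext j
      have h3 := congrFun h (j - q s)
      simp only at h3
      rw [← h2] at h3
      simpa using h3
    · rintro t ⟨ht, ⟨p, hp⟩, h1, h2⟩
      have hs := ht.shift (-p)
      refine ⟨fun j => t (j + -p), ⟨hs, ?_⟩, ?_⟩
      · rw [ht.window_shift]; linarith
      · obtain ⟨h3, h4⟩ := hq _ hs
        set r := q fun j => t (j + -p)
        have h5 : r - 1 + -p < 0 := by
          by_contra h
          have := ht.monotone (not_lt.1 h)
          omega
        have h6 : -1 < r + -p := by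
          by_contra h
          have := ht.monotone (not_lt.1 h)
          omega
        funext j
        simp only
        congr 1
        omega
  rw [← hbij.image_eq, hbij.injOn.ncard_image]

theorem IsStair.strictMono_add (hs : IsStair n s) : StrictMono fun j : ℤ => s j + j + 1 :=
  fun i j h => by
    have := hs.monotone h.le
    simp only
    omega

/-- Crossing at the origin means `0 ≤ s 0 ≤ ... ≤ s (n - 1) < n`, so `s i + i + 1` increases
strictly within `1, ..., 2n - 1`. The sum of these numbers is the window sum plus `n.choose 2 + n`,
which is `n (n - 1) + n` modulo `n`, that is, 0. -/
theorem bijOn_crossingStairs (hn : 1 ≤ n) :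
    Set.BijOn (fun s : ℤ → ℤ => (range n).image fun i : ℕ => (s i + i + 1 : ℤ).toNat) (crossingStairs n)
      ({A ∈ (Icc 1 (2 * n - 1)).powersetCard n | n ∣ ∑ a ∈ A, a} : Finset (Finset ℕ)) := by
  have hrange : ∀ {s}, s ∈ crossingStairs n → ∀ i : ℕ, i < n → 0 ≤ s i ∧ s i < n := by
    rintro s ⟨hs, -, h1, h2⟩ i hi
    have h3 := hs.monotone (show (0 : ℤ) ≤ i by omega)
    have h4 := hs.monotone (show (i : ℤ) ≤ -1 + n by omega)
    rw [hs.add_period] at h4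
    omega
  have hmono : ∀ {s}, s ∈ crossingStairs n → ∀ i j : ℕ, i < j → j < n →
      (s i + i + 1).toNat < (s j + j + 1).toNat := by
    intro s hs i j hij hj
    have h1 := hs.1.strictMono_add (show (i : ℤ) < j by omega)
    have h2 := hrange hs i (by omega)
    simp only at h1
    omega
  have hinj : ∀ {s}, s ∈ crossingStairs n →
      Set.InjOn (fun i : ℕ => (s i + i + 1).toNat) (range n) := by
    intro s hs i hi j hj h
    simp only [coe_range, Set.mem_Iio] at hi hj h
    rcases lt_trichotomy i j with hij | hij | hij
    · have := hmono hs i j hij hj; omega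
    · exact hij
    · have := hmono hs j i hij hi; omega
  have hcard : ∀ {s}, s ∈ crossingStairs n →
      #((range n).image fun i : ℕ => (s i + i + 1).toNat) = n := fun hs => by
    rw [card_image_of_injOn (hinj hs), card_range]
  have h2c : 2 * (n.choose 2 : ℤ) = n * (n - 1) := by
    have h := Nat.choose_two_right n
    have h' := Nat.div_mul_cancel (Nat.even_mul_pred_self n).two_dvd
    rw [← h] at h'
    zify [hn] at h'
    linarith
  refine ⟨?_, ?_, ?_⟩
  · intro s hs
    rw [mem_coe, mem_filter, mem_powersetCard]
    refine ⟨⟨fun a ha => ?_, hcard hs⟩, ?_⟩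
    · obtain ⟨i, hi, rfl⟩ := mem_image.1 ha
      rw [mem_range] at hi
      have := hrange hs i hi
      rw [mem_Icc]
      omega
    · rw [sum_image (hinj hs)]
      zify
      have h1 : ∑ i ∈ range n, (((s i + i + 1).toNat : ℕ) : ℤ) =
          window n s + (n.choose 2 : ℕ) + n := by
        rw [sum_congr rfl fun i hi => Int.toNat_of_nonneg
          (by have := hrange hs i (mem_range.1 hi); omega), sum_add_distrib, sum_add_distrib,
          sum_range_cast]
        simp [window]
      rw [h1]
      obtain ⟨k, hk⟩ := hs.2.1
      refine ⟨k + n, ?_⟩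
      linear_combination hk + h2c
  · intro s hs t ht h
    refine hs.1.ext hn ht.1 fun i hi => ?_
    -- A finite set has only one increasing enumeration, so the image determines the staircase.
    have e : ∀ {u}, u ∈ crossingStairs n →
        ∀ hu : #((range n).image fun i : ℕ => (u i + i + 1).toNat) = n,
        (fun i : Fin n => (u i + i + 1).toNat) =
          (((range n).image fun i : ℕ => (u i + i + 1).toNat).orderEmbOfFin hu) := fun hu hu' =>
      orderEmbOfFin_unique hu' (fun i => mem_image_of_mem (fun i : ℕ => _) (mem_range.2 i.2))
        fun i j hij => hmono hu i j hij j.2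
    have h1 := congrFun (e hs (hcard hs)) ⟨i, hi⟩
    have h2 := congrFun (e ht (hcard ht)) ⟨i, hi⟩
    simp only at h h1 h2
    simp only [h] at h1
    have h3 := h1.trans h2.symm
    have h4 := hrange hs i hi
    have h5 := hrange ht i hi
    omega
  · intro A hA
    rw [mem_coe, mem_filter, mem_powersetCard] at hA
    obtain ⟨⟨hA1, hA2⟩, hA3⟩ := hA
    set a := A.orderEmbOfFin hA2 with ha
    set b : ℕ → ℤ := fun i => if h : i < n then (a ⟨i, h⟩ : ℤ) - i - 1 else 0 with hb
    have hba : ∀ i (h : i < n), b i = (a ⟨i, h⟩ : ℤ) - i - 1 := fun i h => by simp [hb, h]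
    have hmem : ∀ i, 1 ≤ a i ∧ a i ≤ 2 * n - 1 := fun i =>
      mem_Icc.1 (hA1 (orderEmbOfFin_mem A hA2 i))
    have hst : IsStair n (stairExt n b) := by
      refine isStair_stairExt hn (fun i hi => ?_) ?_
      · have h1 : a ⟨i, by omega⟩ < a ⟨i + 1, hi⟩ := a.strictMono (by simp)
        rw [hba i (by omega), hba (i + 1) hi]
        omega
      · have h1 := hmem ⟨n - 1, by omega⟩
        have h2 := hmem ⟨0, by omega⟩
        rw [hba (n - 1) (by omega), hba 0 (by omega)]
        omega
    have himage : ((range n).image fun i : ℕ => (stairExt n b i + i + 1).toNat) = A := by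
      have h1 : ∀ i (h : i < n), (stairExt n b i + i + 1).toNat = a ⟨i, h⟩ := fun i h => by
        rw [stairExt_natCast h, hba i h]
        omega
      ext x
      rw [mem_image]
      constructor
      · rintro ⟨i, hi, rfl⟩
        rw [h1 i (mem_range.1 hi)]
        exact orderEmbOfFin_mem A hA2 _
      · intro hx
        have : x ∈ Set.range a := by rw [range_orderEmbOfFin]; exact hx
        obtain ⟨i, rfl⟩ := this
        exact ⟨i, mem_range.2 i.2, h1 i i.2⟩
    refine ⟨stairExt n b, ⟨hst, ?_, ?_, ?_⟩, himage⟩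
    · have h1 : ∑ x ∈ A, x = ∑ i : Fin n, a i := by
        conv_lhs => rw [← map_orderEmbOfFin_univ A hA2]
        rw [sum_map]
        rfl
      have h2 : window n (stairExt n b) = (∑ x ∈ A, x : ℕ) - (n.choose 2 : ℕ) - n := by
        rw [h1, window, ← sum_range_cast, ← Fin.sum_univ_eq_sum_range (fun i : ℕ => (i : ℤ)),
          ← Fin.sum_univ_eq_sum_range (fun i : ℕ => stairExt n b i)]
        push_cast
        have h3 : (n : ℤ) = ∑ i : Fin n, 1 := by simp
        rw [h3, ← sum_sub_distrib, ← sum_sub_distrib]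
        refine sum_congr rfl fun i _ => ?_
        rw [stairExt_natCast i.2, hba i i.2]
      obtain ⟨k, hk⟩ := hA3
      refine ⟨k - n, ?_⟩
      rw [h2, hk]
      push_cast
      linear_combination -h2c
    · have h1 := hmem ⟨n - 1, by omega⟩
      have e : (-1 : ℤ) = (n - 1 : ℕ) + n * (-1) := by push_cast [hn]; ring
      rw [e, stairExt_apply (by omega), hba (n - 1) (by omega)]
      omega
    · have h1 := hmem ⟨0, by omega⟩
      have e : (0 : ℤ) = (0 : ℕ) := rfl
      rw [e, stairExt_natCast (by omega), hba 0 (by omega)]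
      omega

theorem N_eq_ncard_isCyclic (hn : 1 ≤ n) : N n = {c | IsCyclic n c}.ncard := by
  rw [← (bijOn_balancedStairs hn).image_eq, (bijOn_balancedStairs hn).injOn.ncard_image,
    ncard_balancedStairs_eq hn, N, ← Set.ncard_coe_finset, ← (bijOn_crossingStairs hn).image_eq,
    (bijOn_crossingStairs hn).injOn.ncard_image]

theorem N_eq_sum (hn : 1 ≤ n) : N n = ∑ p ∈ antidiagonal n, p.1 * irrCount p.1 * S p.2 := by
  rw [N_eq_ncard_isCyclic hn, ncard_isCyclic hn, sum_ret_eq hn]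

end Staircase

/-! ### Generating function identities, with coefficients rescaled by `4 ^ n`. -/

section GeneratingFunctions

open Finset PowerSeries

/-- The Euler operator `f ↦ x f'(x)` on power series. -/
noncomputable def euler (f : ℝ⟦X⟧) : ℝ⟦X⟧ := X * derivative ℝ f

theorem coeff_euler (f : ℝ⟦X⟧) (n : ℕ) : coeff n (euler f) = n * coeff n f := by
  cases n with
  | zero => simp [euler]
  | succ n => rw [euler, coeff_succ_X_mul, coeff_derivative]; push_cast; ring

theorem euler_mul (f g : ℝ⟦X⟧) : euler (f * g) = f * euler g + g * euler f := by
  simp only [euler, Derivation.leibniz, smul_eq_mul]; ring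

theorem euler_one_sub (f : ℝ⟦X⟧) : euler (1 - f) = -euler f := by
  simp [euler]

/-- `S n / 4 ^ n`. -/
noncomputable def scoreCoeff (n : ℕ) : ℝ := S n / 4 ^ n

/-- `I n / 4 ^ n`, where `I n` is the number of irreducible score sequences on `K_n`. -/
noncomputable def irrCoeff (n : ℕ) : ℝ := irrCount n / 4 ^ n

/-- `Sirr n m / 4 ^ n`. -/
noncomputable def sirrCoeff (m n : ℕ) : ℝ := Sirr n m / 4 ^ n

/-- `N n / 4 ^ n` for `n ≥ 1`. -/
noncomputable def logDerivCoeff (n : ℕ) : ℝ := if n = 0 then 0 else N n / 4 ^ n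

theorem pow_eq_of_mem_antidiagonal {n : ℕ} {p : ℕ × ℕ} (hp : p ∈ antidiagonal n) :
    (4 : ℝ) ^ n = 4 ^ p.1 * 4 ^ p.2 := by
  rw [← pow_add, HasAntidiagonal.mem_antidiagonal.1 hp]

theorem mk_scoreCoeff_mul : mk scoreCoeff * (1 - mk irrCoeff) = 1 := by
  have h : mk scoreCoeff = 1 + mk irrCoeff * mk scoreCoeff := by
    ext n
    rw [map_add, coeff_mul, coeff_one]
    simp only [coeff_mk, scoreCoeff, irrCoeff]
    rcases Nat.eq_zero_or_pos n with rfl | hn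
    · simp [S_zero, irrCount_zero]
    · rw [if_neg hn.ne', zero_add, S_eq_sum hn]
      push_cast
      rw [sum_div]
      exact sum_congr rfl fun p hp => by rw [pow_eq_of_mem_antidiagonal hp, mul_div_mul_comm]
  linear_combination h

/-- The convention at `n = 0` matters: `N 0 = 1`, while the right side has no constant term. -/
theorem mk_logDerivCoeff : mk logDerivCoeff = euler (mk irrCoeff) * mk scoreCoeff := by
  ext n
  rw [coeff_mul]
  simp only [coeff_euler, coeff_mk, logDerivCoeff, scoreCoeff, irrCoeff]
  rcases Nat.eq_zero_or_pos n with rfl | hn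
  · simp
  · rw [if_neg hn.ne', N_eq_sum hn]
    push_cast
    rw [sum_div]
    exact sum_congr rfl fun p hp => by
      rw [pow_eq_of_mem_antidiagonal hp, mul_div_mul_comm, mul_div_assoc]

/-- Applying `euler` to `S (1 - I) = 1` gives `x S' = (x I' S) S`. -/
theorem mul_scoreCoeff_eq (n : ℕ) : (n : ℝ) * scoreCoeff n =
    ∑ p ∈ antidiagonal n, logDerivCoeff p.1 * scoreCoeff p.2 := by
  have h1 := congrArg euler mk_scoreCoeff_mul
  rw [euler_mul, euler_one_sub, show euler 1 = 0 by simp [euler]] at h1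
  have h2 : euler (mk scoreCoeff) = mk logDerivCoeff * mk scoreCoeff := by
    rw [mk_logDerivCoeff]
    linear_combination mk scoreCoeff * h1 - euler (mk scoreCoeff) * mk_scoreCoeff_mul
  have h3 := congrArg (coeff n) h2
  simpa only [coeff_euler, coeff_mul, coeff_mk] using h3

/-- The coefficients of the inverse of the generating function of `scoreCoeff`. -/
noncomputable def invCoeff (n : ℕ) : ℝ := (if n = 0 then 1 else 0) - irrCoeff n

/-- The inverse series `1 - I` obeys the recursion with the opposite sign, so the same analytic
lemmas yield the asymptotics of irreducible sequences. -/
theorem mul_invCoeff_eq (n : ℕ) : (n : ℝ) * invCoeff n =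
    ∑ p ∈ antidiagonal n, -logDerivCoeff p.1 * invCoeff p.2 := by
  have h0 : mk invCoeff = 1 - mk irrCoeff := by
    ext n
    simp only [invCoeff, map_sub, coeff_mk, coeff_one]
  have h2 : euler (mk invCoeff) = -mk logDerivCoeff * mk invCoeff := by
    rw [mk_logDerivCoeff, h0, euler_one_sub]
    linear_combination euler (mk irrCoeff) * mk_scoreCoeff_mul
  have h3 := congrArg (coeff n) h2
  simpa only [coeff_euler, coeff_mul, coeff_mk, map_neg] using h3

theorem sirrCoeff_succ (m n : ℕ) :
    sirrCoeff (m + 1) n = ∑ p ∈ antidiagonal n, irrCoeff p.1 * sirrCoeff m p.2 := by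
  simp only [sirrCoeff, irrCoeff]
  rcases Nat.eq_zero_or_pos n with rfl | hn
  · simp [Sirr_zero_left, irrCount_zero]
  · rw [Sirr_succ_eq_sum hn]
    push_cast
    rw [sum_div]
    exact sum_congr rfl fun p hp => by rw [pow_eq_of_mem_antidiagonal hp, mul_div_mul_comm]

theorem sirrCoeff_zero (n : ℕ) : sirrCoeff 0 n = if n = 0 then 1 else 0 := by
  rcases Nat.eq_zero_or_pos n with rfl | hn
  · simp [sirrCoeff, Sirr_zero_left]
  · rw [sirrCoeff, Sirr_zero_right hn, if_neg hn.ne']; simp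

end GeneratingFunctions

/-! ### Values at `x = 1/4` and coefficient asymptotics. -/

section Limits

open Finset

theorem tendsto_rpow_mul_logDerivCoeff :
    Tendsto (fun n : ℕ => (n : ℝ) ^ (3 / 2 : ℝ) * logDerivCoeff n) atTop
      (𝓝 (1 / (2 * Real.sqrt Real.pi))) := by
  refine tendsto_rpow_mul_N_div.congr' ?_
  filter_upwards [eventually_ne_atTop 0] with n hn
  rw [logDerivCoeff, if_neg hn]

theorem logDerivCoeff_div_succ (k : ℕ) :
    logDerivCoeff (k + 1) / (k + 1 : ℕ) = lamTerm (k + 1) := by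
  rw [logDerivCoeff, if_neg k.succ_ne_zero, lamTerm]
  field_simp

theorem summable_logDerivCoeff_div : Summable fun n : ℕ => logDerivCoeff n / n := by
  have h := summable_of_tendsto_rpow_mul (by norm_num) tendsto_rpow_mul_logDerivCoeff
  refine Summable.of_norm_bounded h.abs fun n => ?_
  rcases Nat.eq_zero_or_pos n with rfl | hn
  · simp
  · rw [norm_div, Real.norm_natCast]
    exact div_le_self (abs_nonneg _) (by exact_mod_cast hn)

theorem summable_lamTerm : Summable fun k : ℕ => lamTerm (k + 1) := by
  have := (summable_nat_add_iff 1).2 summable_logDerivCoeff_div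
  simpa only [logDerivCoeff_div_succ] using this

theorem tsum_logDerivCoeff_div : ∑' n : ℕ, logDerivCoeff n / n = lam := by
  rw [summable_logDerivCoeff_div.tsum_eq_zero_add, lam]
  simp only [logDerivCoeff_div_succ]
  simp

theorem lam_nonneg : 0 ≤ lam := tsum_nonneg fun k => by unfold lamTerm; positivity

/-- `S n ~ e^λ 4^n / (2 √π n^(5/2))`. -/
theorem tendsto_rpow_mul_scoreCoeff :
    Tendsto (fun n : ℕ => (n : ℝ) ^ (5 / 2 : ℝ) * scoreCoeff n) atTop
      (𝓝 (1 / (2 * Real.sqrt Real.pi) * Real.exp lam)) := by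
  have h := tendsto_of_convolution_recursion tendsto_rpow_mul_logDerivCoeff mul_scoreCoeff_eq
  rw [tsum_of_convolution_recursion (by simp [logDerivCoeff]) tendsto_rpow_mul_logDerivCoeff
    mul_scoreCoeff_eq, tsum_logDerivCoeff_div] at h
  simpa [scoreCoeff, S_zero] using h

theorem tendsto_rpow_mul_neg_logDerivCoeff :
    Tendsto (fun n : ℕ => (n : ℝ) ^ (3 / 2 : ℝ) * -logDerivCoeff n) atTop
      (𝓝 (-(1 / (2 * Real.sqrt Real.pi)))) := by
  simpa only [mul_neg] using tendsto_rpow_mul_logDerivCoeff.neg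

theorem tsum_invCoeff : ∑' n, invCoeff n = Real.exp (-lam) := by
  rw [tsum_of_convolution_recursion (by simp [logDerivCoeff]) tendsto_rpow_mul_neg_logDerivCoeff
    mul_invCoeff_eq]
  simp only [neg_div, tsum_neg, tsum_logDerivCoeff_div]
  simp [invCoeff, irrCoeff, irrCount_zero]

theorem tendsto_rpow_mul_irrCoeff :
    Tendsto (fun n : ℕ => (n : ℝ) ^ (5 / 2 : ℝ) * irrCoeff n) atTop
      (𝓝 (1 / (2 * Real.sqrt Real.pi) * Real.exp (-lam))) := by
  have h := (tendsto_of_convolution_recursion tendsto_rpow_mul_neg_logDerivCoeff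
    mul_invCoeff_eq).neg
  rw [tsum_invCoeff, neg_mul, neg_neg] at h
  refine h.congr' ?_
  filter_upwards [eventually_ne_atTop 0] with n hn
  rw [invCoeff, if_neg hn]; ring

theorem summable_irrCoeff : Summable irrCoeff :=
  summable_of_tendsto_rpow_mul (by norm_num) tendsto_rpow_mul_irrCoeff

theorem tsum_irrCoeff : ∑' n, irrCoeff n = 1 - Real.exp (-lam) := by
  have h0 : HasSum (fun n : ℕ => if n = 0 then (1 : ℝ) else 0) 1 := hasSum_ite_eq 0 1
  have h := (h0.sub summable_irrCoeff.hasSum).tsum_eq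
  have h' := tsum_invCoeff
  simp only [invCoeff] at h'
  linarith

theorem sirrCoeff_asymptotics (m : ℕ) : Summable (sirrCoeff m) ∧
    ∑' n, sirrCoeff m n = (1 - Real.exp (-lam)) ^ m ∧
    Tendsto (fun n : ℕ => (n : ℝ) ^ (5 / 2 : ℝ) * sirrCoeff m n) atTop
      (𝓝 (m * (1 - Real.exp (-lam)) ^ (m - 1) *
        (1 / (2 * Real.sqrt Real.pi) * Real.exp (-lam)))) := by
  induction m with
  | zero =>
    have h0 : HasSum (sirrCoeff 0) 1 := by
      simp only [funext sirrCoeff_zero]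
      exact hasSum_ite_eq 0 1
    refine ⟨h0.summable, by simpa using h0.tsum_eq, ?_⟩
    simp only [Nat.cast_zero, zero_mul]
    refine tendsto_const_nhds.congr' ?_
    filter_upwards [eventually_ne_atTop 0] with n hn
    rw [sirrCoeff_zero, if_neg hn, mul_zero]
  | succ m ih =>
    obtain ⟨h1, h2, h3⟩ := ih
    -- Either the first block is giant, contributing the total mass of the other `m`, or it is small
    -- and one of those `m` is giant; the two terms combine to the factor `m + 1`.
    have h4 := tendsto_rpow_mul_convolution (by norm_num) summable_irrCoeff h1
      tendsto_rpow_mul_irrCoeff h3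
    simp only [← sirrCoeff_succ] at h4
    refine ⟨summable_of_tendsto_rpow_mul (by norm_num) h4, ?_, ?_⟩
    · simp only [sirrCoeff_succ]
      rw [← tsum_mul_tsum_eq_tsum_sum_antidiagonal_of_summable_norm summable_irrCoeff.norm h1.norm,
        tsum_irrCoeff, h2, pow_succ, mul_comm]
    · convert h4 using 2
      rw [tsum_irrCoeff, h2]
      cases m with
      | zero => simp
      | succ m =>
        simp only [Nat.add_sub_cancel]
        push_cast
        ring

theorem tendsto_Sirr_div_S (m : ℕ) :
    Tendsto (fun n : ℕ => (Sirr n m : ℝ) / (S n : ℝ)) atTop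
      (𝓝 ((m : ℝ) * (1 - Real.exp (-lam)) ^ (m - 1) * Real.exp (-2 * lam))) := by
  have hπ : 0 < Real.sqrt Real.pi := by positivity
  have h := (sirrCoeff_asymptotics m).2.2.div tendsto_rpow_mul_scoreCoeff (by positivity)
  have e : (m : ℝ) * (1 - Real.exp (-lam)) ^ (m - 1) * Real.exp (-2 * lam) =
      m * (1 - Real.exp (-lam)) ^ (m - 1) * (1 / (2 * Real.sqrt Real.pi) * Real.exp (-lam)) /
        (1 / (2 * Real.sqrt Real.pi) * Real.exp lam) := by
    have : Real.exp (-2 * lam) = Real.exp (-lam) / Real.exp lam := by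
      rw [← Real.exp_sub]; congr 1; ring
    rw [this]
    field_simp
  rw [e]
  refine h.congr' ?_
  filter_upwards [eventually_gt_atTop 0] with n hn
  have h1 : (n : ℝ) ^ (5 / 2 : ℝ) ≠ 0 :=
    (Real.rpow_pos_of_pos (by exact_mod_cast hn) _).ne'
  simp only [Pi.div_apply, sirrCoeff, scoreCoeff]
  rw [mul_div_mul_left _ _ h1, div_div_div_cancel_right₀ (by positivity)]

theorem tendsto_rpow_mul_Sirr (m : ℕ) :
    Tendsto (fun n : ℕ => (n : ℝ) ^ (5 / 2 : ℝ) * (Sirr n m : ℝ) / 4 ^ n) atTop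
      (𝓝 ((m : ℝ) * (1 - Real.exp (-lam)) ^ (m - 1) * Real.exp (-lam) /
        (2 * Real.sqrt Real.pi))) := by
  convert (sirrCoeff_asymptotics m).2.2 using 2
  · rw [sirrCoeff, mul_div_assoc]
  · ring

end Limits

end ScoreSeq

theorem corollary5
    -- for every `n`, a uniformly random score sequence `s n` on `K_n`
    {Ω : ℕ → Type*} [∀ n, MeasurableSpace (Ω n)]
    (P : ∀ n, Measure (Ω n)) [∀ n, IsProbabilityMeasure (P n)]
    (s : ∀ n, Ω n → (Fin n → ℕ))
    (hs : ∀ n, HasLaw (s n) (uniformOn (ScoreSeq.scoreSequences n)) (P n))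
    -- a negative binomial random variable with parameters `2` and `exp (-λ)`
    {Ω' : Type*} [MeasurableSpace Ω'] (P' : Measure Ω') [IsProbabilityMeasure P']
    (𝒩 : Ω' → ℕ)
    (h𝒩 : HasLaw 𝒩 (ScoreSeq.negBinomialMeasure 2 (Real.exp (-ScoreSeq.lam))) P') :
    -- the series defining `λ` converges
    Summable (fun k : ℕ => ScoreSeq.lamTerm (k + 1)) ∧
    -- convergence in distribution of the number of irreducible subscores
    TendstoInDistribution (fun n ω => ScoreSeq.numIrreducible (s n ω)) atTop
      (fun ω => 1 + 𝒩 ω) P P' ∧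
    -- the pointwise form
    (∀ m : ℕ, 1 ≤ m →
      (∀ n : ℕ, (P n).real {ω | ScoreSeq.numIrreducible (s n ω) = m} =
        (ScoreSeq.Sirr n m : ℝ) / (ScoreSeq.S n : ℝ)) ∧
      Tendsto (fun n : ℕ => (ScoreSeq.Sirr n m : ℝ) / (ScoreSeq.S n : ℝ)) atTop
        (𝓝 ((m : ℝ) * (1 - Real.exp (-ScoreSeq.lam)) ^ (m - 1) *
          Real.exp (-2 * ScoreSeq.lam))) ∧
      (m : ℝ) * (1 - Real.exp (-ScoreSeq.lam)) ^ (m - 1) * Real.exp (-2 * ScoreSeq.lam) =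
        P'.real {ω | 𝒩 ω = m - 1}) ∧
    -- the asymptotics of the number of score sequences with `m` irreducible subscores
    (∀ m : ℕ, 1 ≤ m →
      Tendsto (fun n : ℕ => (n : ℝ) ^ (5 / 2 : ℝ) * (ScoreSeq.Sirr n m : ℝ) / 4 ^ n) atTop
        (𝓝 ((m : ℝ) * (1 - Real.exp (-ScoreSeq.lam)) ^ (m - 1) * Real.exp (-ScoreSeq.lam) /
          (2 * Real.sqrt Real.pi)))) := by
  have hexp : Real.exp (-ScoreSeq.lam) ≤ 1 := Real.exp_le_one_iff.2 (by
    linarith [ScoreSeq.lam_nonneg])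
  have hpmf : ∀ m : ℕ, 1 ≤ m → (m : ℝ) * (1 - Real.exp (-ScoreSeq.lam)) ^ (m - 1) *
      Real.exp (-2 * ScoreSeq.lam) = P'.real {ω | 𝒩 ω = m - 1} := by
    intro m hm
    rw [ScoreSeq.measureReal_eq_of_hasLaw_negBinomial hexp h𝒩 (m - 1), ← Real.exp_nat_mul]
    push_cast [hm]
    rw [sub_add_cancel, mul_neg, neg_mul]
  have hlaw : ∀ n m : ℕ, (P n).real {ω | ScoreSeq.numIrreducible (s n ω) = m} =
      (ScoreSeq.Sirr n m : ℝ) / (ScoreSeq.S n : ℝ) := fun n m =>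
    ScoreSeq.measureReal_numIrreducible_eq (hs n) m
  refine ⟨ScoreSeq.summable_lamTerm, ?_, fun m hm => ⟨fun n => hlaw n m,
    ScoreSeq.tendsto_Sirr_div_S m, hpmf m hm⟩, fun m _ => ScoreSeq.tendsto_rpow_mul_Sirr m⟩
  refine ScoreSeq.tendstoInDistribution_of_tendsto_measure_eq
    (fun n => (Measurable.of_discrete (f := ScoreSeq.numIrreducible)).comp_aemeasurable
      (hs n).aemeasurable)
    ((Measurable.of_discrete (f := fun k : ℕ => 1 + k)).comp_aemeasurable h𝒩.aemeasurable)
    fun m => ?_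
  rw [← ENNReal.tendsto_toReal_iff (fun n => measure_ne_top _ _) (measure_ne_top _ _)]
  change Tendsto (fun n => (P n).real {ω | ScoreSeq.numIrreducible (s n ω) = m}) atTop
    (𝓝 (P'.real {ω | 1 + 𝒩 ω = m}))
  simp only [hlaw]
  convert ScoreSeq.tendsto_Sirr_div_S m using 2
  -- At `m = 0` both sides vanish: the limit has the factor `m`, and `1 + 𝒩` is never 0.
  rcases Nat.eq_zero_or_pos m with rfl | hm
  · simp
  · rw [hpmf m hm]
    congr 1
    ext ω
    change 1 + 𝒩 ω = m ↔ 𝒩 ω = m - 1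
    omega
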